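/- Let $p(y|x_1,x_2)$ be a two-sender discrete memoryless multiple access channel (MAC) with arbitrary finite input alphabets $\mathcal X_1,\mathcal X_2$ and finite output alphabet $\mathcal Y$. Fix a logarithm base $b>1$, the same for all information measures and rates. For input pmfs $p(x_1),p(x_2)$ let $(X_1,X_2,Y)\sim p(x_1)p(x_2)p(y|x_1,x_2)$, let $\mathscr R_{\mathrm{MAC}}(X_1,X_2)$ be the set of $(R_1,R_2)$ with $$R_1<I(X_1;Y|X_2),\qquad R_2<I(X_2;Y|X_1),\qquad R_1+R_2<I(X_1,X_2;Y),$$ and let $\mathscr R_{\mathrm L}'(X_1,X_2)$ be the set of $(R_1,R_2)$ with $\min(R_1,R_2)<\max\{I(X_1;Y),I(X_2;Y)\}$. A rate pair $(R_1,R_2)$ with $R_1,R_2\ge 0$ is called achievable by random coset codes in a finite field with the same generator matrix if there are a finite field $\mathbb F_q$ and symbol-by-symbol mappings $\varphi_j:\mathbb F_q\to\mathcal X_j$, $j=1,2$ (a channel transformation), such that the following holds. For each block length $n$ let $k_j=\lceil nR_j\log_q b\rceil$ (the least integer with $q^{k_j}\ge b^{nR_j}$) and $\kappa=\max(k_1,k_2)$,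 let $G\in\mathbb F_q^{\kappa\times n}$ and $D_1^n,D_2^n\in\mathbb F_q^n$ have i.i.d. uniform entries, and let sender $j$ encode the message $m_j\in\mathbb F_q^{k_j}$ as $$u_j^n(m_j)=[\,m_j\ \ \mathbf 0_{\kappa-k_j}\,]\,G+D_j^n,$$ transmitting $x_{ji}=\varphi_j(u_{ji})$, $i=1,\dots,n$. Then there are decoders, which know $(G,D_1^n,D_2^n)$ and estimate $(m_1,m_2)$ from $y^n$, for which the average probability of error $P_e^{(n)}$ (over independent messages, each uniformly distributed) satisfies $\lim_{n\to\infty}\mathbb E[P_e^{(n)}]=0$, the expectation being over $G,D_1^n,D_2^n$. Corollary. If $R_1,R_2\ge0$ and $$(R_1,R_2)\in\mathscr R_{\mathrm{MAC}}(X_1,X_2)\cap\mathscr R_{\mathrm L}'(X_1,X_2)$$ for some input pmfs $p(x_1)$ and $p(x_2)$, then $(R_1,R_2)$ is achievable for the MAC $p(y|x_1,x_2)$ by random coset codes in some finite field with the same generator matrix. -/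

import Mathlib

namespace CosetMAC

/-! ### Entropy and mutual information of finite random variables

A finite probability space is a finite type `Ω` with a pmf `P : Ω → ℝ`; random variables are
functions on `Ω`. All information measures are in a fixed logarithm base `b`. -/

open Classical in
/-- The pmf of the random variable `f` under the pmf `P`. -/
noncomputable def law {Ω A : Type*} [Fintype Ω] (P : Ω → ℝ) (f : Ω → A) : A → ℝ :=
  fun a => ∑ ω, if f ω = a then P ω else 0

/-- The entropy `H(f)` of the random variable `f` under the pmf `P`. -/
noncomputable def entropy {Ω A : Type*} [Fintype Ω] [Fintype A] (b : ℝ) (P : Ω → ℝ)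
    (f : Ω → A) : ℝ :=
  -∑ a, law P f a * Real.logb b (law P f a)

/-- The mutual information `I(f; g) = H(f) + H(g) - H(f, g)`. -/
noncomputable def mutualInfo {Ω A B : Type*} [Fintype Ω] [Fintype A] [Fintype B]
    (b : ℝ) (P : Ω → ℝ) (f : Ω → A) (g : Ω → B) : ℝ :=
  entropy b P f + entropy b P g - entropy b P (fun ω => (f ω, g ω))

/-- The conditional mutual information
`I(f; g | h) = H(f, h) + H(g, h) - H(f, g, h) - H(h)`. -/
noncomputable def condMutualInfo {Ω A B C : Type*} [Fintype Ω] [Fintype A] [Fintype B]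
    [Fintype C] (b : ℝ) (P : Ω → ℝ) (f : Ω → A) (g : Ω → B) (h : Ω → C) : ℝ :=
  entropy b P (fun ω => (f ω, h ω)) + entropy b P (fun ω => (g ω, h ω))
    - entropy b P (fun ω => (f ω, g ω, h ω)) - entropy b P h

/-! ### Rate regions of a two-sender discrete memoryless MAC

The channel `p(y | x₁, x₂)` is `W x₁ x₂ y`. -/

/-- The joint pmf `p(x₁) p(x₂) p(y | x₁, x₂)`. -/
def joint {X₁ X₂ Y : Type*} (p₁ : X₁ → ℝ) (p₂ : X₂ → ℝ) (W : X₁ → X₂ → Y → ℝ) :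
    X₁ × X₂ × Y → ℝ :=
  fun ω => p₁ ω.1 * p₂ ω.2.1 * W ω.1 ω.2.1 ω.2.2

/-- The region `R₁ < I(X₁; Y | X₂)`, `R₂ < I(X₂; Y | X₁)`, `R₁ + R₂ < I(X₁, X₂; Y)`. -/
def macRegion {X₁ X₂ Y : Type*} [Fintype X₁] [Fintype X₂] [Fintype Y] (b : ℝ)
    (p₁ : X₁ → ℝ) (p₂ : X₂ → ℝ) (W : X₁ → X₂ → Y → ℝ) : Set (ℝ × ℝ) :=
  {R | R.1 < condMutualInfo b (joint p₁ p₂ W) (fun ω => ω.1) (fun ω => ω.2.2) (fun ω => ω.2.1) ∧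
    R.2 < condMutualInfo b (joint p₁ p₂ W) (fun ω => ω.2.1) (fun ω => ω.2.2) (fun ω => ω.1) ∧
    R.1 + R.2 < mutualInfo b (joint p₁ p₂ W) (fun ω => (ω.1, ω.2.1)) (fun ω => ω.2.2)}

/-- The region `min(R₁, R₂) < max(I(X₁; Y), I(X₂; Y))`. -/
def minRegion {X₁ X₂ Y : Type*} [Fintype X₁] [Fintype X₂] [Fintype Y] (b : ℝ)
    (p₁ : X₁ → ℝ) (p₂ : X₂ → ℝ) (W : X₁ → X₂ → Y → ℝ) : Set (ℝ × ℝ) :=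
  {R | min R.1 R.2 <
    max (mutualInfo b (joint p₁ p₂ W) (fun ω => ω.1) (fun ω => ω.2.2))
      (mutualInfo b (joint p₁ p₂ W) (fun ω => ω.2.1) (fun ω => ω.2.2))}

/-! ### Random coset codes with a common generator matrix over a transformed channel -/

/-- The padded row vector `[m 0]` of length `κ`. It is only used for `k ≤ κ`. -/
def zeroPad {F : Type*} [Zero F] {k : ℕ} (κ : ℕ) (m : Fin k → F) : Fin κ → F :=
  fun i => if h : (i : ℕ) < k then m ⟨i, h⟩ else 0

/-- The codeword `[m 0] G + d` of the message `m` in the coset code with generator matrix `G`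
and coset leader `d`. -/
def codeword {F : Type*} [Field F] {k κ n : ℕ} (G : Matrix (Fin κ) (Fin n) F) (d : Fin n → F)
    (m : Fin k → F) : Fin n → F :=
  Matrix.vecMul (zeroPad κ m) G + d

/-- The probability that `n` uses of the memoryless channel `W` with inputs `x₁, x₂` give the
output sequence `y`. -/
def blockProb {X₁ X₂ Y : Type*} (W : X₁ → X₂ → Y → ℝ) {n : ℕ} (x₁ : Fin n → X₁)
    (x₂ : Fin n → X₂) (y : Fin n → Y) : ℝ :=
  ∏ i, W (x₁ i) (x₂ i) (y i)

/-- Decoders for the message pairs `F ^ k₁ × F ^ k₂` from output sequences of length `n`. -/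
abbrev Decoder (F Y : Type*) (n k₁ k₂ : ℕ) : Type _ :=
  (Fin n → Y) → (Fin k₁ → F) × (Fin k₂ → F)

open Classical in
/-- The average probability of error (over independent messages, each uniformly distributed) of
the pair of coset codes with common generator matrix `G` and coset leaders `d₁`, `d₂`, used over
the virtual channel `p(y | u₁, u₂) = W (φ₁ u₁) (φ₂ u₂) y` with the decoder `dec`. -/
noncomputable def errorProb {F X₁ X₂ Y : Type*} [Field F] [Fintype F] [Fintype Y]
    (W : X₁ → X₂ → Y → ℝ) (φ₁ : F → X₁) (φ₂ : F → X₂) {n k₁ k₂ : ℕ}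
    (G : Matrix (Fin (max k₁ k₂)) (Fin n) F) (d₁ d₂ : Fin n → F)
    (dec : Decoder F Y n k₁ k₂) : ℝ :=
  Finset.expect Finset.univ fun m : (Fin k₁ → F) × (Fin k₂ → F) =>
    ∑ y : Fin n → Y, if dec y = m then 0 else
      blockProb W (fun i => φ₁ (codeword G d₁ m.1 i)) (fun i => φ₂ (codeword G d₂ m.2 i)) y

open Classical in
/-- The expectation of the average probability of error when the entries of `G`, `d₁`, `d₂` are
i.i.d. uniform on `F`. The decoder is informed of the code. -/
noncomputable def ensembleErrorProb {F X₁ X₂ Y : Type*} [Field F] [Fintype F] [Fintype Y]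
    (W : X₁ → X₂ → Y → ℝ) (φ₁ : F → X₁) (φ₂ : F → X₂) {n k₁ k₂ : ℕ}
    (dec : Matrix (Fin (max k₁ k₂)) (Fin n) F → (Fin n → F) → (Fin n → F) →
      Decoder F Y n k₁ k₂) : ℝ :=
  Finset.expect Finset.univ fun G : Matrix (Fin (max k₁ k₂)) (Fin n) F =>
    Finset.expect Finset.univ fun d : (Fin n → F) × (Fin n → F) =>
      errorProb W φ₁ φ₂ G d.1 d.2 (dec G d.1 d.2)

/-- The number of message symbols in `F` at block length `n` and rate `R`, with rates measured in
base `b`: the least `k` such that `b ^ (n * R) ≤ |F| ^ k`. -/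
noncomputable def numSymbols (F : Type*) [Fintype F] (b R : ℝ) (n : ℕ) : ℕ :=
  ⌈(n : ℝ) * R * Real.logb (Fintype.card F) b⌉₊

/-- `(R₁, R₂)` is achievable for the MAC `W` by random coset codes in `F` with the same generator
matrix, after the channel transformation given by `φ₁`, `φ₂`. -/
def AchievableOver (F : Type*) {X₁ X₂ Y : Type*} [Field F] [Fintype F] [Fintype Y] (b : ℝ)
    (W : X₁ → X₂ → Y → ℝ) (φ₁ : F → X₁) (φ₂ : F → X₂) (R : ℝ × ℝ) : Prop :=
  ∃ dec : ∀ n : ℕ,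
      Matrix (Fin (max (numSymbols F b R.1 n) (numSymbols F b R.2 n))) (Fin n) F →
      (Fin n → F) → (Fin n → F) →
      Decoder F Y n (numSymbols F b R.1 n) (numSymbols F b R.2 n),
    Filter.Tendsto (fun n => ensembleErrorProb W φ₁ φ₂ (dec n)) Filter.atTop (nhds 0)

/-- `(R₁, R₂)` is achievable for the MAC `W` by random coset codes in some finite field with the
same generator matrix, after some channel transformation. -/
def AchievableByCosetCodes {X₁ X₂ Y : Type*} [Fintype Y] (b : ℝ)
    (W : X₁ → X₂ → Y → ℝ) (R : ℝ × ℝ) : Prop :=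
  ∃ (F : Type) (_ : Field F) (_ : Fintype F) (φ₁ : F → X₁) (φ₂ : F → X₂),
    AchievableOver F b W φ₁ φ₂ R

end CosetMAC

namespace CosetMAC

/-! Composing the channel with the symbol maps gives a virtual channel `K` on the plane `F × F`. The
two codes share one generator matrix, so the offset between the codeword pairs of two message pairs
with difference `δ` is, symbol by symbol, independent and uniform on `diffSpace δ`, the span of the
pairs of symbols of `δ`. The coset leaders make the true codeword pair uniform whatever the matrix
is.

The decoder tests `K` against its smoothing along every nonzero subspace `V`, with threshold `b ^ (n
* τ)`. The true pair fails with exponentially small probability if `τ < cosetInfo b K V`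
(`exists_fail_bound`), and a wrong pair whose offset is uniform on `V` passes with probability at
most `b ^ (-n * τ)` (`expect_pass_le`). A union bound therefore reduces achievability to one
inequality for each `V`: the number of `δ` spanning `V` must grow at a rate below `cosetInfo b K V`
(`achievableOver_of_card_le`).

The nonzero subspaces of the plane are the plane, the two axes, and lines through neither axis. The
first three give the sum-rate and single-rate conditions. On an oblique line either component of `δ`
determines the other, so the growth rate is `min R₁ R₂`; by the entropy inequality
`negCosetEnt_add_le`, the information along the line is at least `I(X₁; Y)` and at least `I(X₂; Y)`.

Only the images of uniform laws on a finite field arise as input pmfs. These approximate every pmf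
as the field grows, and the rate conditions are strict and continuous in the pmfs. -/

/-- The function `t ↦ t log t` in base `b`. -/
noncomputable def xlog (b t : ℝ) : ℝ := t * Real.logb b t

/-- This is the source of every entropy chain rule below. The convention `0 log 0 = 0` removes any
need for positivity. -/
lemma xlog_mul (b s t : ℝ) : xlog b (s * t) = s * xlog b t + t * xlog b s := by
  unfold xlog
  rcases eq_or_ne s 0 with rfl | hs
  · simp
  rcases eq_or_ne t 0 with rfl | ht
  · simp
  rw [Real.logb_mul hs ht]; ring

lemma continuous_xlog (b : ℝ) : Continuous (xlog b) := by
  have : xlog b = fun t => t * Real.log t / Real.log b := by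
    funext t; simp [xlog, Real.logb, mul_div_assoc]
  rw [this]
  exact Real.continuous_mul_log.div_const _

lemma entropy_eq_neg_sum_xlog {Ω A : Type*} [Fintype Ω] [Fintype A] (b : ℝ) (P : Ω → ℝ)
    (f : Ω → A) : entropy b P f = -∑ a, xlog b (law P f a) := rfl

/-! ### Marginals of the joint law -/

section Laws

variable {X₁ X₂ Y : Type*} [Fintype X₁] [Fintype X₂] [Fintype Y]
  {p₁ : X₁ → ℝ} {p₂ : X₂ → ℝ} {W : X₁ → X₂ → Y → ℝ}

lemma law_joint {A : Type*} (f : X₁ × X₂ × Y → A) (a : A) [DecidableEq A] :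
    law (joint p₁ p₂ W) f a =
      ∑ x₁, ∑ x₂, ∑ y, if f (x₁, x₂, y) = a then p₁ x₁ * p₂ x₂ * W x₁ x₂ y else 0 := by
  simp only [law, joint, Fintype.sum_prod_type]

lemma law_joint_all (x₁ : X₁) (x₂ : X₂) (y : Y) :
    law (joint p₁ p₂ W) (fun ω => (ω.1, ω.2.2, ω.2.1)) (x₁, y, x₂) =
      p₁ x₁ * p₂ x₂ * W x₁ x₂ y := by
  classical
  rw [law_joint]
  simp only [Prod.mk.injEq]
  rw [Finset.sum_eq_single x₁ (by intro c _ hc; simp [hc]) (by simp),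
    Finset.sum_eq_single x₂ (by intro c _ hc; simp [hc]) (by simp),
    Finset.sum_eq_single y (by intro c _ hc; simp [hc]) (by simp)]
  simp

lemma law_joint_all' (x₁ : X₁) (x₂ : X₂) (y : Y) :
    law (joint p₁ p₂ W) (fun ω => (ω.2.1, ω.2.2, ω.1)) (x₂, y, x₁) =
      p₁ x₁ * p₂ x₂ * W x₁ x₂ y := by
  classical
  rw [law_joint]
  simp only [Prod.mk.injEq]
  rw [Finset.sum_eq_single x₁ (by intro c _ hc; simp [hc]) (by simp),
    Finset.sum_eq_single x₂ (by intro c _ hc; simp [hc]) (by simp),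
    Finset.sum_eq_single y (by intro c _ hc; simp [hc]) (by simp)]
  simp

lemma law_joint_inputs_output (x₁ : X₁) (x₂ : X₂) (y : Y) :
    law (joint p₁ p₂ W) (fun ω => ((ω.1, ω.2.1), ω.2.2)) ((x₁, x₂), y) =
      p₁ x₁ * p₂ x₂ * W x₁ x₂ y := by
  classical
  rw [law_joint]
  simp only [Prod.mk.injEq]
  rw [Finset.sum_eq_single x₁ (by intro c _ hc; simp [hc]) (by simp),
    Finset.sum_eq_single x₂ (by intro c _ hc; simp [hc]) (by simp),
    Finset.sum_eq_single y (by intro c _ hc; simp [hc]) (by simp)]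
  simp

lemma law_joint_inputs (hW : ∀ x₁ x₂, ∑ y, W x₁ x₂ y = 1) (x₁ : X₁) (x₂ : X₂) :
    law (joint p₁ p₂ W) (fun ω => (ω.1, ω.2.1)) (x₁, x₂) = p₁ x₁ * p₂ x₂ := by
  classical
  rw [law_joint]
  simp only [Prod.mk.injEq]
  rw [Finset.sum_eq_single x₁ (by intro c _ hc; simp [hc]) (by simp),
    Finset.sum_eq_single x₂ (by intro c _ hc; simp [hc]) (by simp)]
  simp [← Finset.mul_sum, hW]

lemma law_joint_inputs' (hW : ∀ x₁ x₂, ∑ y, W x₁ x₂ y = 1) (x₁ : X₁) (x₂ : X₂) :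
    law (joint p₁ p₂ W) (fun ω => (ω.2.1, ω.1)) (x₂, x₁) = p₁ x₁ * p₂ x₂ := by
  classical
  rw [law_joint]
  simp only [Prod.mk.injEq]
  rw [Finset.sum_eq_single x₁ (by intro c _ hc; simp [hc]) (by simp),
    Finset.sum_eq_single x₂ (by intro c _ hc; simp [hc]) (by simp)]
  simp [← Finset.mul_sum, hW]

lemma law_joint_fst (hp₂ : ∑ x, p₂ x = 1) (hW : ∀ x₁ x₂, ∑ y, W x₁ x₂ y = 1) (x₁ : X₁) :
    law (joint p₁ p₂ W) (fun ω => ω.1) x₁ = p₁ x₁ := by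
  classical
  rw [law_joint, Finset.sum_eq_single x₁ (by intro c _ hc; simp [hc]) (by simp)]
  simp [← Finset.mul_sum, hW, hp₂]

lemma law_joint_snd (hp₁ : ∑ x, p₁ x = 1) (hW : ∀ x₁ x₂, ∑ y, W x₁ x₂ y = 1) (x₂ : X₂) :
    law (joint p₁ p₂ W) (fun ω => ω.2.1) x₂ = p₂ x₂ := by
  classical
  rw [law_joint, Finset.sum_comm,
    Finset.sum_eq_single x₂ (by intro c _ hc; simp [hc]) (by simp)]
  simp [← Finset.mul_sum, ← Finset.sum_mul, hW, hp₁]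

lemma law_joint_output (y : Y) :
    law (joint p₁ p₂ W) (fun ω => ω.2.2) y = ∑ x₁, ∑ x₂, p₁ x₁ * p₂ x₂ * W x₁ x₂ y := by
  classical
  rw [law_joint]
  simp

lemma law_joint_fst_output (x₁ : X₁) (y : Y) :
    law (joint p₁ p₂ W) (fun ω => (ω.1, ω.2.2)) (x₁, y) =
      p₁ x₁ * ∑ x₂, p₂ x₂ * W x₁ x₂ y := by
  classical
  rw [law_joint]
  simp only [Prod.mk.injEq]
  rw [Finset.sum_eq_single x₁ (by intro c _ hc; simp [hc]) (by simp)]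
  simp [Finset.mul_sum, mul_assoc]

lemma law_joint_output_fst (x₁ : X₁) (y : Y) :
    law (joint p₁ p₂ W) (fun ω => (ω.2.2, ω.1)) (y, x₁) =
      p₁ x₁ * ∑ x₂, p₂ x₂ * W x₁ x₂ y := by
  classical
  rw [law_joint]
  simp only [Prod.mk.injEq]
  rw [Finset.sum_eq_single x₁ (by intro c _ hc; simp [hc]) (by simp)]
  simp [Finset.mul_sum, mul_assoc]

lemma law_joint_snd_output (x₂ : X₂) (y : Y) :
    law (joint p₁ p₂ W) (fun ω => (ω.2.1, ω.2.2)) (x₂, y) =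
      p₂ x₂ * ∑ x₁, p₁ x₁ * W x₁ x₂ y := by
  classical
  rw [law_joint, Finset.sum_comm]
  simp only [Prod.mk.injEq]
  rw [Finset.sum_eq_single x₂ (by intro c _ hc; simp [hc]) (by simp)]
  simp [Finset.mul_sum, mul_assoc, mul_left_comm]

lemma law_joint_output_snd (x₂ : X₂) (y : Y) :
    law (joint p₁ p₂ W) (fun ω => (ω.2.2, ω.2.1)) (y, x₂) =
      p₂ x₂ * ∑ x₁, p₁ x₁ * W x₁ x₂ y := by
  classical
  rw [law_joint, Finset.sum_comm]
  simp only [Prod.mk.injEq]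
  rw [Finset.sum_eq_single x₂ (by intro c _ hc; simp [hc]) (by simp)]
  simp [Finset.mul_sum, mul_assoc, mul_left_comm]

end Laws

/-! ### Information measures as differences of conditional entropies -/

section Functionals

variable {X₁ X₂ Y : Type*} [Fintype X₁] [Fintype X₂] [Fintype Y]

/-- The negative conditional entropy `-H(Y | X₁, X₂)`. -/
noncomputable def negEntBoth (b : ℝ) (W : X₁ → X₂ → Y → ℝ) (p₁ : X₁ → ℝ) (p₂ : X₂ → ℝ) : ℝ :=
  ∑ x₁, ∑ x₂, ∑ y, p₁ x₁ * p₂ x₂ * xlog b (W x₁ x₂ y)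

/-- The negative conditional entropy `-H(Y | X₁)`. -/
noncomputable def negEntFst (b : ℝ) (W : X₁ → X₂ → Y → ℝ) (p₁ : X₁ → ℝ) (p₂ : X₂ → ℝ) : ℝ :=
  ∑ x₁, ∑ y, p₁ x₁ * xlog b (∑ x₂, p₂ x₂ * W x₁ x₂ y)

/-- The negative conditional entropy `-H(Y | X₂)`. -/
noncomputable def negEntSnd (b : ℝ) (W : X₁ → X₂ → Y → ℝ) (p₁ : X₁ → ℝ) (p₂ : X₂ → ℝ) : ℝ :=
  ∑ x₂, ∑ y, p₂ x₂ * xlog b (∑ x₁, p₁ x₁ * W x₁ x₂ y)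

/-- The negative entropy `-H(Y)`. -/
noncomputable def negEntOut (b : ℝ) (W : X₁ → X₂ → Y → ℝ) (p₁ : X₁ → ℝ) (p₂ : X₂ → ℝ) : ℝ :=
  ∑ y, xlog b (∑ x₁, ∑ x₂, p₁ x₁ * p₂ x₂ * W x₁ x₂ y)

variable {p₁ : X₁ → ℝ} {p₂ : X₂ → ℝ} {W : X₁ → X₂ → Y → ℝ} {b : ℝ}

lemma sum_xlog_joint (hW : ∀ x₁ x₂, ∑ y, W x₁ x₂ y = 1) :
    ∑ x₁, ∑ x₂, ∑ y, xlog b (p₁ x₁ * p₂ x₂ * W x₁ x₂ y) =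
      negEntBoth b W p₁ p₂ + ∑ x₁, ∑ x₂, xlog b (p₁ x₁ * p₂ x₂) := by
  simp only [xlog_mul b (_ * _) (W _ _ _), Finset.sum_add_distrib, ← Finset.sum_mul, hW, one_mul,
    negEntBoth]

lemma sum_xlog_fst_output (hp₂ : ∑ x, p₂ x = 1) (hW : ∀ x₁ x₂, ∑ y, W x₁ x₂ y = 1) :
    ∑ x₁, ∑ y, xlog b (p₁ x₁ * ∑ x₂, p₂ x₂ * W x₁ x₂ y) =
      negEntFst b W p₁ p₂ + ∑ x₁, xlog b (p₁ x₁) := by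
  have h : ∀ x₁, ∑ y, ∑ x₂, p₂ x₂ * W x₁ x₂ y = 1 := fun x₁ => by
    rw [Finset.sum_comm]; simp [← Finset.mul_sum, hW, hp₂]
  simp only [xlog_mul b (p₁ _), Finset.sum_add_distrib, ← Finset.sum_mul, h, one_mul, negEntFst]

lemma sum_xlog_snd_output (hp₁ : ∑ x, p₁ x = 1) (hW : ∀ x₁ x₂, ∑ y, W x₁ x₂ y = 1) :
    ∑ x₂, ∑ y, xlog b (p₂ x₂ * ∑ x₁, p₁ x₁ * W x₁ x₂ y) =
      negEntSnd b W p₁ p₂ + ∑ x₂, xlog b (p₂ x₂) := by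
  have h : ∀ x₂, ∑ y, ∑ x₁, p₁ x₁ * W x₁ x₂ y = 1 := fun x₂ => by
    rw [Finset.sum_comm]; simp [← Finset.mul_sum, hW, hp₁]
  simp only [xlog_mul b (p₂ _), Finset.sum_add_distrib, ← Finset.sum_mul, h, one_mul, negEntSnd]

/-- In conditional-entropy form, continuity in the input pmfs is evident and comparison with coset
entropies is possible. -/
lemma condMutualInfo_fst (hp₁ : ∑ x, p₁ x = 1)
    (hW : ∀ x₁ x₂, ∑ y, W x₁ x₂ y = 1) :
    condMutualInfo b (joint p₁ p₂ W) (fun ω => ω.1) (fun ω => ω.2.2) (fun ω => ω.2.1) =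
      negEntBoth b W p₁ p₂ - negEntSnd b W p₁ p₂ := by
  have h₁ := sum_xlog_joint (b := b) (p₁ := p₁) (p₂ := p₂) hW
  have h₂ := sum_xlog_snd_output (b := b) (p₂ := p₂) hp₁ hW
  rw [Finset.sum_comm] at h₂
  have h₃ : ∀ x₁, ∑ x₂, ∑ y, xlog b (p₁ x₁ * p₂ x₂ * W x₁ x₂ y) =
    ∑ y, ∑ x₂, xlog b (p₁ x₁ * p₂ x₂ * W x₁ x₂ y) := fun x₁ => Finset.sum_comm
  simp only [h₃] at h₁
  simp only [condMutualInfo, entropy_eq_neg_sum_xlog, Fintype.sum_prod_type, law_joint_all,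
    law_joint_inputs hW, law_joint_snd hp₁ hW, law_joint_output_snd, h₁, h₂]
  ring

lemma condMutualInfo_snd (hp₂ : ∑ x, p₂ x = 1)
    (hW : ∀ x₁ x₂, ∑ y, W x₁ x₂ y = 1) :
    condMutualInfo b (joint p₁ p₂ W) (fun ω => ω.2.1) (fun ω => ω.2.2) (fun ω => ω.1) =
      negEntBoth b W p₁ p₂ - negEntFst b W p₁ p₂ := by
  have h₁ := sum_xlog_joint (b := b) (p₁ := p₁) (p₂ := p₂) hW
  have h₂ := sum_xlog_fst_output (b := b) (p₁ := p₁) hp₂ hW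
  rw [Finset.sum_comm] at h₂
  have h₃ : ∑ x₁, ∑ x₂, ∑ y, xlog b (p₁ x₁ * p₂ x₂ * W x₁ x₂ y) =
      ∑ x₂, ∑ y, ∑ x₁, xlog b (p₁ x₁ * p₂ x₂ * W x₁ x₂ y) := by
    rw [Finset.sum_comm]
    exact Finset.sum_congr rfl fun _ _ => Finset.sum_comm
  have h₄ : ∑ x₁, ∑ x₂, xlog b (p₁ x₁ * p₂ x₂) = ∑ x₂, ∑ x₁, xlog b (p₁ x₁ * p₂ x₂) :=
    Finset.sum_comm
  rw [h₃, h₄] at h₁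
  simp only [condMutualInfo, entropy_eq_neg_sum_xlog, Fintype.sum_prod_type, law_joint_all',
    law_joint_inputs' hW, law_joint_fst hp₂ hW, law_joint_output_fst, h₁, h₂]
  ring

lemma mutualInfo_inputs (hW : ∀ x₁ x₂, ∑ y, W x₁ x₂ y = 1) :
    mutualInfo b (joint p₁ p₂ W) (fun ω => (ω.1, ω.2.1)) (fun ω => ω.2.2) =
      negEntBoth b W p₁ p₂ - negEntOut b W p₁ p₂ := by
  have h₁ := sum_xlog_joint (b := b) (p₁ := p₁) (p₂ := p₂) hW
  simp only [mutualInfo, entropy_eq_neg_sum_xlog, Fintype.sum_prod_type,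
    law_joint_inputs_output, law_joint_inputs hW, law_joint_output, h₁, negEntOut]
  ring

lemma mutualInfo_fst (hp₂ : ∑ x, p₂ x = 1)
    (hW : ∀ x₁ x₂, ∑ y, W x₁ x₂ y = 1) :
    mutualInfo b (joint p₁ p₂ W) (fun ω => ω.1) (fun ω => ω.2.2) =
      negEntFst b W p₁ p₂ - negEntOut b W p₁ p₂ := by
  have h₂ := sum_xlog_fst_output (b := b) (p₁ := p₁) hp₂ hW
  simp only [mutualInfo, entropy_eq_neg_sum_xlog, Fintype.sum_prod_type,
    law_joint_fst_output, law_joint_fst hp₂ hW, law_joint_output, h₂, negEntOut]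
  ring

lemma mutualInfo_snd (hp₁ : ∑ x, p₁ x = 1)
    (hW : ∀ x₁ x₂, ∑ y, W x₁ x₂ y = 1) :
    mutualInfo b (joint p₁ p₂ W) (fun ω => ω.2.1) (fun ω => ω.2.2) =
      negEntSnd b W p₁ p₂ - negEntOut b W p₁ p₂ := by
  have h₂ := sum_xlog_snd_output (b := b) (p₂ := p₂) hp₁ hW
  simp only [mutualInfo, entropy_eq_neg_sum_xlog, Fintype.sum_prod_type,
    law_joint_snd_output, law_joint_snd hp₁ hW, law_joint_output, h₂, negEntOut]
  ring

lemma continuous_negEntBoth (b : ℝ) (W : X₁ → X₂ → Y → ℝ) :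
    Continuous fun p : (X₁ → ℝ) × (X₂ → ℝ) => negEntBoth b W p.1 p.2 := by
  unfold negEntBoth
  fun_prop

lemma continuous_negEntFst (b : ℝ) (W : X₁ → X₂ → Y → ℝ) :
    Continuous fun p : (X₁ → ℝ) × (X₂ → ℝ) => negEntFst b W p.1 p.2 := by
  have := continuous_xlog b
  unfold negEntFst
  fun_prop

lemma continuous_negEntSnd (b : ℝ) (W : X₁ → X₂ → Y → ℝ) :
    Continuous fun p : (X₁ → ℝ) × (X₂ → ℝ) => negEntSnd b W p.1 p.2 := by
  have := continuous_xlog b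
  unfold negEntSnd
  fun_prop

lemma continuous_negEntOut (b : ℝ) (W : X₁ → X₂ → Y → ℝ) :
    Continuous fun p : (X₁ → ℝ) × (X₂ → ℝ) => negEntOut b W p.1 p.2 := by
  have := continuous_xlog b
  unfold negEntOut
  fun_prop

end Functionals

/-! ### Uniform averages and a Chernoff bound -/

/-- A surjective homomorphism carries the uniform law to the uniform law. Averaging `g (f a + c)`
over both `a` and `c` in the two orders shows this without counting fibres. -/
lemma expect_comp_surjective {A B : Type*} [AddCommGroup A] [AddCommGroup B] [Fintype A]
    [Fintype B] (f : A →+ B) (hf : Function.Surjective f) (g : B → ℝ) :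
    (Finset.expect Finset.univ fun a => g (f a)) = Finset.expect Finset.univ g := by
  obtain ⟨s, hs⟩ := hf.hasRightInverse
  have h₁ : ∀ c : B, (Finset.expect Finset.univ fun a => g (f a + c)) =
      Finset.expect Finset.univ fun a => g (f a) := fun c =>
    Fintype.expect_equiv (Equiv.addRight (s c)) _ _ fun a => by simp [hs c]
  have h₂ : ∀ a : A, (Finset.expect Finset.univ fun c => g (f a + c)) =
      Finset.expect Finset.univ g := fun a =>
    Fintype.expect_equiv (Equiv.addLeft (f a)) _ _ fun c => by simp
  calc (Finset.expect Finset.univ fun a => g (f a))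
      = Finset.expect Finset.univ fun c : B => Finset.expect Finset.univ fun a => g (f a + c) := by
        simp only [h₁, Finset.expect_const Finset.univ_nonempty]
    _ = Finset.expect Finset.univ fun a : A => Finset.expect Finset.univ fun c => g (f a + c) :=
        Finset.expect_comm _ _ _
    _ = _ := by simp only [h₂, Finset.expect_const Finset.univ_nonempty]

lemma expect_prod_pi {A : Type*} [Fintype A] {n : ℕ} (h : Fin n → A → ℝ) :
    (Finset.expect Finset.univ fun v : Fin n → A => ∏ i, h i (v i)) =
      ∏ i, Finset.expect Finset.univ (h i) := by
  classical
  simp only [Fintype.expect_eq_sum_div_card, Finset.prod_div_distrib, Fintype.prod_sum]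
  simp

open Classical in
/-- A Chernoff bound: the sum of `n` independent copies of a random variable with positive mean is
nonpositive with exponentially small probability. -/
lemma exists_exponential_tail {S : Type*} [Fintype S] (P : S → ℝ) (hP : ∀ s, 0 ≤ P s)
    (hP₁ : ∑ s, P s = 1) (ℓ : S → ℝ) (hℓ : 0 < ∑ s, P s * ℓ s) :
    ∃ c : ℝ, 0 ≤ c ∧ c < 1 ∧ ∀ n : ℕ,
      (∑ s : Fin n → S, if ∑ i, ℓ (s i) ≤ 0 then ∏ i, P (s i) else 0) ≤ c ^ n := by
  obtain ⟨t, ht, htc⟩ : ∃ t : ℝ, 0 < t ∧ ∑ s, P s * Real.exp (-t * ℓ s) < 1 := by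
    -- The moment generating function at `-t` equals 1 at `t = 0` and has there the derivative minus
    -- the mean, so it drops below 1 for some small `t > 0`.
    have hd : HasDerivAt (fun t : ℝ => ∑ s, P s * Real.exp (-t * ℓ s))
        (∑ s, P s * (Real.exp (-0 * ℓ s) * (-1 * ℓ s))) 0 :=
      HasDerivAt.fun_sum fun s _ =>
        (((hasDerivAt_id (0 : ℝ)).neg.mul_const (ℓ s)).exp).const_mul (P s)
    have hneg : (∑ s, P s * (Real.exp (-0 * ℓ s) * (-1 * ℓ s))) < 0 := by
      simpa using hℓ
    have hev := (hasDerivAt_iff_tendsto_slope.1 hd).eventually (gt_mem_nhds hneg)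
    have hev' : ∀ᶠ t in nhdsWithin (0 : ℝ) (Set.Ioi 0),
        slope (fun t : ℝ => ∑ s, P s * Real.exp (-t * ℓ s)) 0 t < 0 :=
      hev.filter_mono (nhdsWithin_mono _ fun t ht => ne_of_gt ht)
    obtain ⟨t, hs, ht⟩ := (hev'.and self_mem_nhdsWithin).exists
    refine ⟨t, ht, ?_⟩
    have ht' : (0 : ℝ) < t := ht
    rw [slope_def_field, div_lt_iff₀ (by simpa using ht')] at hs
    simp [hP₁] at hs
    simpa using hs
  refine ⟨_, Finset.sum_nonneg fun s _ => mul_nonneg (hP s) (Real.exp_pos _).le, htc, fun n => ?_⟩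
  rw [Fintype.sum_pow]
  refine Finset.sum_le_sum fun s _ => ?_
  rw [Finset.prod_mul_distrib, ← Real.exp_sum, ← Finset.mul_sum]
  have h0 : 0 ≤ ∏ i, P (s i) := Finset.prod_nonneg fun i _ => hP _
  split_ifs with h
  · exact le_mul_of_one_le_right h0 (Real.one_le_exp (by nlinarith))
  · exact mul_nonneg h0 (Real.exp_pos _).le

/-! ### Smoothing along a subspace and the threshold test -/

section Smooth

variable {F A Y : Type*} [Field F] [AddCommGroup A] [Module F A] [Fintype A]

open Classical in
/-- The channel `K` with its input perturbed by uniform noise on the subspace `V`. -/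
noncomputable def smooth (K : A → Y → ℝ) (V : Submodule F A) (u : A) (y : Y) : ℝ :=
  Finset.expect Finset.univ fun v : V => K (u + v) y

variable {K : A → Y → ℝ} {V : Submodule F A}

lemma smooth_add_mem (u : A) {v : A} (hv : v ∈ V) (y : Y) :
    smooth K V (u + v) y = smooth K V u y := by
  classical
  exact Fintype.expect_equiv (Equiv.addLeft (⟨v, hv⟩ : V)) _ _ fun a => by simp [add_assoc]

lemma smooth_nonneg (hK : ∀ u y, 0 ≤ K u y) (u : A) (y : Y) : 0 ≤ smooth K V u y :=
  Finset.expect_nonneg fun _ _ => hK _ _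

lemma smooth_pos (hK : ∀ u y, 0 ≤ K u y) {u : A} {y : Y} (h : 0 < K u y) :
    0 < smooth K V u y :=
  Finset.expect_pos' (fun _ _ => hK _ _) ⟨0, by simp, by simpa using h⟩

variable [Fintype Y]

/-- The conditional mutual information, in base `b`, of a uniform input `U` and the output of the
channel `K` given the coset `U + V`. -/
noncomputable def cosetInfo (b : ℝ) (K : A → Y → ℝ) (V : Submodule F A) : ℝ :=
  Finset.expect Finset.univ fun u : A =>
    ∑ y, K u y * (Real.logb b (K u y) - Real.logb b (smooth K V u y))

/-- The threshold test comparing the channel `K` with its smoothing along `V`. -/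
def Passes (K : A → Y → ℝ) (V : Submodule F A) (B : ℝ) {n : ℕ} (u : Fin n → A) (y : Fin n → Y) :
    Prop :=
  B * ∏ i, smooth K V (u i) (y i) < ∏ i, K (u i) (y i)

open Classical in
-- Failing the test means that the sum of the log-likelihood ratios, each reduced by `τ`, is
-- nonpositive. Under a uniform input each term has mean `cosetInfo b K V - τ > 0`, so the Chernoff
-- bound applies.
lemma exists_fail_bound [Nonempty A] {b τ : ℝ} (hb : 1 < b) (hK : ∀ u y, 0 ≤ K u y)
    (hK₁ : ∀ u, ∑ y, K u y = 1) (hτ : τ < cosetInfo b K V) :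
    ∃ c : ℝ, 0 ≤ c ∧ c < 1 ∧ ∀ n : ℕ,
      (Finset.expect Finset.univ fun u : Fin n → A => ∑ y : Fin n → Y,
        if Passes K V (b ^ (n * τ)) u y then 0 else ∏ i, K (u i) (y i)) ≤ c ^ n := by
  have hb₀ : 0 < b := by linarith
  have hcard : (0 : ℝ) < Fintype.card A := by exact_mod_cast Fintype.card_pos
  let P : A × Y → ℝ := fun s => K s.1 s.2 / Fintype.card A
  let ℓ : A × Y → ℝ := fun s =>
    Real.logb b (K s.1 s.2) - Real.logb b (smooth K V s.1 s.2) - τ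
  have hP₁ : ∑ s, P s = 1 := by
    simp only [P, Fintype.sum_prod_type, ← Finset.sum_div, hK₁]
    simp [hcard.ne']
  have hmean : ∑ s, P s * ℓ s = cosetInfo b K V - τ := by
    have : ∀ s, P s * ℓ s = K s.1 s.2 * (Real.logb b (K s.1 s.2) -
        Real.logb b (smooth K V s.1 s.2)) / Fintype.card A - P s * τ := fun s => by
      simp only [P, ℓ]; ring
    rw [Finset.sum_congr rfl fun s _ => this s, Finset.sum_sub_distrib, ← Finset.sum_mul, hP₁,
      one_mul, cosetInfo, Fintype.expect_eq_sum_div_card, Fintype.sum_prod_type, Finset.sum_div]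
    simp only [Finset.sum_div]
  obtain ⟨c, hc₀, hc₁, hc⟩ := exists_exponential_tail P
    (fun s => div_nonneg (hK _ _) hcard.le) hP₁ ℓ (by rw [hmean]; linarith)
  refine ⟨c, hc₀, hc₁, fun n => le_trans ?_ (hc n)⟩
  rw [Fintype.expect_eq_sum_div_card, Finset.sum_div,
    ← (Equiv.arrowProdEquivProdArrow (Fin n) (fun _ => A) fun _ => Y).symm.sum_comp,
    Fintype.sum_prod_type]
  refine Finset.sum_le_sum fun u _ => ?_
  rw [Finset.sum_div]
  refine Finset.sum_le_sum fun y _ => ?_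
  change _ ≤ if ∑ i, ℓ (u i, y i) ≤ 0 then ∏ i, K (u i) (y i) / Fintype.card A else 0
  have hprod : (∏ i, K (u i) (y i)) / (Fintype.card (Fin n → A) : ℝ) =
      ∏ i, K (u i) (y i) / Fintype.card A := by
    simp [Finset.prod_div_distrib]
  have hnn : 0 ≤ ∏ i, K (u i) (y i) / Fintype.card A :=
    Finset.prod_nonneg fun i _ => div_nonneg (hK _ _) hcard.le
  by_cases hpass : Passes K V (b ^ (n * τ)) u y
  · rw [if_pos hpass, zero_div]
    split_ifs
    exacts [hnn, le_rfl]
  rw [if_neg hpass, hprod]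
  -- Logarithms are meaningful only where every factor is positive; elsewhere the weight vanishes.
  by_cases hz : ∃ i, K (u i) (y i) = 0
  · obtain ⟨i, hi⟩ := hz
    have : ∏ i, K (u i) (y i) / (Fintype.card A : ℝ) = 0 :=
      Finset.prod_eq_zero (Finset.mem_univ i) (by simp [hi])
    simp [this]
  push Not at hz
  have hpos : ∀ i, 0 < K (u i) (y i) := fun i => lt_of_le_of_ne (hK _ _) (hz i).symm
  have hspos : ∀ i, 0 < smooth K V (u i) (y i) := fun i => smooth_pos hK (hpos i)
  rw [if_pos]
  simp only [ℓ]
  have hle := not_lt.1 hpass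
  have hlog := Real.logb_le_logb_of_le hb (Finset.prod_pos fun i _ => hpos i) hle
  rw [Real.logb_mul (Real.rpow_pos_of_pos hb₀ _).ne' (Finset.prod_pos fun i _ => hspos i).ne',
    Real.logb_rpow hb₀ hb.ne', Real.logb_prod _ _ fun i _ => hz i,
    Real.logb_prod _ _ fun i _ => (hspos i).ne'] at hlog
  simp only [Finset.sum_sub_distrib, Finset.sum_const, Finset.card_univ, Fintype.card_fin,
    nsmul_eq_mul]
  linarith

open Classical in
/-- A wrong input sequence whose offset from the true one is uniform on `V` passes the test with
probability at most `1 / B`. -/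
lemma expect_pass_le {B : ℝ} (hB : 0 < B) (hK : ∀ u y, 0 ≤ K u y) (hK₁ : ∀ u, ∑ y, K u y = 1)
    {n : ℕ} (u : Fin n → A) :
    (Finset.expect Finset.univ fun v : Fin n → V => ∑ y : Fin n → Y,
      if Passes K V B (fun i => u i + v i) y then ∏ i, K (u i) (y i) else 0) ≤ 1 / B := by
  have hsum : ∑ y : Fin n → Y, ∏ i, K (u i) (y i) = 1 := by
    rw [← Fintype.prod_sum]; simp [hK₁]
  rw [Finset.expect_sum_comm]
  calc _ ≤ ∑ y : Fin n → Y, (∏ i, K (u i) (y i)) * (1 / B) := Finset.sum_le_sum fun y _ => ?_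
    _ = 1 / B := by rw [← Finset.sum_mul, hsum, one_mul]
  have hk : 0 ≤ ∏ i, K (u i) (y i) := Finset.prod_nonneg fun i _ => hK _ _
  rcases hk.eq_or_lt with h0 | hpos
  · simp [← h0]
  have hKpos : ∀ i, 0 < K (u i) (y i) := fun i =>
    lt_of_le_of_ne (hK _ _) fun h => hpos.ne' (Finset.prod_eq_zero (Finset.mem_univ i) h.symm)
  have hS : 0 < ∏ i, smooth K V (u i) (y i) := Finset.prod_pos fun i _ => smooth_pos hK (hKpos i)
  have hS' : (Finset.expect Finset.univ fun v : Fin n → V => ∏ i, K (u i + v i) (y i)) =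
      ∏ i, smooth K V (u i) (y i) :=
    expect_prod_pi fun i (v : V) => K (u i + v) (y i)
  -- Markov's inequality, pointwise: the smoothing is constant on cosets of `V`, so passing bounds
  -- the likelihood of the shifted input below by `B` times the smoothed likelihood at `u`.
  -- Averaging over `v` then cancels the smoothed likelihood.
  have hpt : ∀ v : Fin n → V,
      (if Passes K V B (fun i => u i + v i) y then ∏ i, K (u i) (y i) else 0) ≤
        (∏ i, K (u i) (y i)) / (B * ∏ i, smooth K V (u i) (y i)) *
          ∏ i, K (u i + v i) (y i) := fun v => by
    have hv : 0 ≤ ∏ i, K (u i + v i) (y i) := Finset.prod_nonneg fun i _ => hK _ _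
    split_ifs with h
    · unfold Passes at h
      simp only [smooth_add_mem _ (v _).2] at h
      rw [div_mul_eq_mul_div, le_div_iff₀ (mul_pos hB hS)]
      exact mul_le_mul_of_nonneg_left h.le hk
    · positivity
  refine (Finset.expect_le_expect fun v _ => hpt v).trans ?_
  rw [← Finset.mul_expect, hS']
  apply le_of_eq
  field_simp

end Smooth

/-! ### Distribution of codeword pairs -/

section Code

variable {F : Type*} [Field F] {k₁ k₂ n : ℕ}

lemma zeroPad_sub {k : ℕ} (κ : ℕ) (m m' : Fin k → F) :
    zeroPad κ (m' - m) = zeroPad κ m' - zeroPad κ m := by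
  funext i
  simp only [zeroPad, Pi.sub_apply]
  split_ifs <;> simp

lemma zeroPad_apply_castLE {k κ : ℕ} (h : k ≤ κ) (m : Fin k → F) (i : Fin k) :
    zeroPad κ m (Fin.castLE h i) = m i := by
  simp [zeroPad]

/-- The span of the pairs of symbols of a pair of zero-padded messages. -/
noncomputable def diffSpace (δ : (Fin k₁ → F) × (Fin k₂ → F)) : Submodule F (F × F) :=
  LinearMap.range (Fintype.linearCombination F
    fun j : Fin (max k₁ k₂) => (zeroPad (max k₁ k₂) δ.1 j, zeroPad (max k₁ k₂) δ.2 j))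

lemma zeroPad_mem_diffSpace (δ : (Fin k₁ → F) × (Fin k₂ → F)) (j : Fin (max k₁ k₂)) :
    (zeroPad (max k₁ k₂) δ.1 j, zeroPad (max k₁ k₂) δ.2 j) ∈ diffSpace δ := by
  rw [diffSpace, Fintype.range_linearCombination]
  exact Submodule.subset_span ⟨j, rfl⟩

/-- Padding discards no symbol, since `k₁` and `k₂` are at most their maximum. Hence only nonzero
subspaces have to be tested. -/
lemma diffSpace_ne_bot {δ : (Fin k₁ → F) × (Fin k₂ → F)} (hδ : δ ≠ 0) : diffSpace δ ≠ ⊥ := by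
  intro h
  apply hδ
  have hj : ∀ j, zeroPad (max k₁ k₂) δ.1 j = 0 ∧ zeroPad (max k₁ k₂) δ.2 j = 0 := fun j => by
    have := zeroPad_mem_diffSpace δ j
    rw [h] at this
    simpa using this
  refine Prod.ext (funext fun i => ?_) (funext fun i => ?_)
  · rw [← zeroPad_apply_castLE (le_max_left k₁ k₂) δ.1 i]; exact (hj _).1
  · rw [← zeroPad_apply_castLE (le_max_right k₁ k₂) δ.2 i]; exact (hj _).2

/-- The pair of codewords of a message pair, as a sequence of pairs of symbols. -/
def wordPair (G : Matrix (Fin (max k₁ k₂)) (Fin n) F) (d : (Fin n → F) × (Fin n → F))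
    (m : (Fin k₁ → F) × (Fin k₂ → F)) : Fin n → F × F :=
  fun i => (codeword G d.1 m.1 i, codeword G d.2 m.2 i)

/-- The coset leaders cancel in the difference, and at each position both components of the offset
use the same column of `G` as coefficients. -/
lemma wordPair_eq_add (G : Matrix (Fin (max k₁ k₂)) (Fin n) F) (d : (Fin n → F) × (Fin n → F))
    (m m' : (Fin k₁ → F) × (Fin k₂ → F)) :
    wordPair G d m' = fun i => wordPair G d m i +
      Fintype.linearCombination F (fun j : Fin (max k₁ k₂) =>
        (zeroPad (max k₁ k₂) (m' - m).1 j, zeroPad (max k₁ k₂) (m' - m).2 j)) (fun j => G j i) := by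
  funext i
  have h : ∀ {k : ℕ} (d : Fin n → F) (m m' : Fin k → F),
      codeword G d m' i = codeword G d m i + ∑ j, G j i * zeroPad (max k₁ k₂) (m' - m) j :=
    fun d m m' => by
      simp only [codeword, zeroPad_sub, Pi.add_apply, Matrix.vecMul, dotProduct, Pi.sub_apply,
        mul_sub, Finset.sum_sub_distrib, mul_comm]
      ring
  simp only [wordPair, Fintype.linearCombination_apply]
  rw [h d.1 m.1 m'.1, h d.2 m.2 m'.2]
  refine Prod.ext ?_ ?_ <;> simp [Prod.fst_sum, Prod.snd_sum]

variable [Fintype F]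

/-- For fixed `G` the coset leaders translate the codeword pair uniformly, so the true pair is
uniform and independent of `G`, hence of all offsets. -/
lemma expect_wordPair (G : Matrix (Fin (max k₁ k₂)) (Fin n) F)
    (m : (Fin k₁ → F) × (Fin k₂ → F)) (h : (Fin n → F × F) → ℝ) :
    (Finset.expect Finset.univ fun d : (Fin n → F) × (Fin n → F) => h (wordPair G d m)) =
      Finset.expect Finset.univ h := by
  refine Fintype.expect_equiv ((Equiv.addLeft
    (Matrix.vecMul (zeroPad (max k₁ k₂) m.1) G, Matrix.vecMul (zeroPad (max k₁ k₂) m.2) G)).trans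
      (Equiv.arrowProdEquivProdArrow (Fin n) (fun _ => F) fun _ => F).symm) _ _ fun d => ?_
  rfl

open Classical in
-- The columns of `G` are independent and uniform, and a linear map sends the uniform law to the
-- uniform law on its range.
lemma expect_matrix_linearCombination (δ : (Fin k₁ → F) × (Fin k₂ → F))
    (h : (Fin n → F × F) → ℝ) :
    (Finset.expect Finset.univ fun G : Matrix (Fin (max k₁ k₂)) (Fin n) F =>
      h fun i => Fintype.linearCombination F (fun j : Fin (max k₁ k₂) =>
        (zeroPad (max k₁ k₂) δ.1 j, zeroPad (max k₁ k₂) δ.2 j)) (fun j => G j i)) =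
      Finset.expect Finset.univ fun v : Fin n → diffSpace δ => h fun i => v i := by
  let L := Fintype.linearCombination F (fun j : Fin (max k₁ k₂) =>
        (zeroPad (max k₁ k₂) δ.1 j, zeroPad (max k₁ k₂) δ.2 j))
  let f : Matrix (Fin (max k₁ k₂)) (Fin n) F →+ (Fin n → diffSpace δ) :=
    { toFun := fun G i => L.rangeRestrict fun j => G j i
      map_zero' := by
        funext i
        exact map_zero L.rangeRestrict
      map_add' := fun G G' => by
        funext i
        exact map_add L.rangeRestrict (fun j => G j i) fun j => G' j i }
  have hf : Function.Surjective f := fun v => by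
    choose g hg using fun i => L.surjective_rangeRestrict (v i)
    exact ⟨fun j i => g i j, funext fun i => hg i⟩
  exact expect_comp_surjective f hf fun v => h fun i => v i

end Code

/-! ### Union bound for the threshold decoder -/

section Decoding

variable {F Y : Type*} [Field F] [Fintype F] {k₁ k₂ n : ℕ}

open Classical in
/-- The decoder that returns the unique message pair passing the threshold tests along all nonzero
subspaces. -/
noncomputable def thresholdDecoder (K : F × F → Y → ℝ) (B : Submodule F (F × F) → ℝ)
    (G : Matrix (Fin (max k₁ k₂)) (Fin n) F) (d₁ d₂ : Fin n → F) : Decoder F Y n k₁ k₂ :=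
  fun y => if h : ∃! m : (Fin k₁ → F) × (Fin k₂ → F),
    ∀ V : Submodule F (F × F), V ≠ ⊥ → Passes K V (B V) (wordPair G (d₁, d₂) m) y
    then h.choose else 0

variable {K : F × F → Y → ℝ} {B : Submodule F (F × F) → ℝ}

open Classical in
-- An error requires that the true pair fail some test or that another pair pass them all. A
-- competitor `m'` is charged only for the test along `diffSpace (m' - m)`, the space on which its
-- offset is uniform.
lemma thresholdDecoder_error_le (G : Matrix (Fin (max k₁ k₂)) (Fin n) F)
    (d : (Fin n → F) × (Fin n → F)) (m : (Fin k₁ → F) × (Fin k₂ → F)) (y : Fin n → Y) {p : ℝ}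
    (hp : 0 ≤ p) :
    (if thresholdDecoder K B G d.1 d.2 y = m then 0 else p) ≤
      (∑ V with V ≠ ⊥, if Passes K V (B V) (wordPair G d m) y then 0 else p) +
        ∑ m' with m' ≠ m,
          if Passes K (diffSpace (m' - m)) (B (diffSpace (m' - m))) (wordPair G d m') y
            then p else 0 := by
  have h₁ : ∀ V ∈ Finset.univ.filter fun V : Submodule F (F × F) => V ≠ ⊥,
      0 ≤ if Passes K V (B V) (wordPair G d m) y then 0 else p :=
    fun V _ => by split_ifs <;> simp [hp]
  have h₂ : ∀ m' ∈ Finset.univ.filter fun m' => m' ≠ m,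
      0 ≤ if Passes K (diffSpace (m' - m)) (B (diffSpace (m' - m))) (wordPair G d m') y
            then p else 0 := fun V _ => by split_ifs <;> simp [hp]
  by_cases hdec : thresholdDecoder K B G d.1 d.2 y = m
  · rw [if_pos hdec]
    exact add_nonneg (Finset.sum_nonneg h₁) (Finset.sum_nonneg h₂)
  rw [if_neg hdec]
  by_cases hm : ∀ V : Submodule F (F × F), V ≠ ⊥ → Passes K V (B V) (wordPair G d m) y
  · obtain ⟨m', hne, hm'⟩ : ∃ m', m' ≠ m ∧
        Passes K (diffSpace (m' - m)) (B (diffSpace (m' - m))) (wordPair G d m') y := by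
      by_contra hcon
      push Not at hcon
      apply hdec
      have hu : ∃! m : (Fin k₁ → F) × (Fin k₂ → F), ∀ V : Submodule F (F × F), V ≠ ⊥ →
          Passes K V (B V) (wordPair G (d.1, d.2) m) y :=
        ⟨m, hm, fun m' hm' => by
          by_contra hne
          exact hcon m' hne (hm' _ (diffSpace_ne_bot (sub_ne_zero.2 hne)))⟩
      rw [thresholdDecoder, dif_pos hu]
      exact hu.unique hu.choose_spec.1 hm
    have := Finset.single_le_sum h₂ (Finset.mem_filter.2 ⟨Finset.mem_univ m', hne⟩)
    rw [if_pos hm'] at this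
    linarith [Finset.sum_nonneg h₁]
  · push Not at hm
    obtain ⟨V, hV, hfail⟩ := hm
    have := Finset.single_le_sum h₁ (Finset.mem_filter.2 ⟨Finset.mem_univ V, hV⟩)
    rw [if_neg hfail] at this
    linarith [Finset.sum_nonneg h₂]

variable [Fintype Y]

open Classical in
lemma ensembleErrorProb_eq_expect_message {X₁ X₂ : Type*} {W : X₁ → X₂ → Y → ℝ}
    {φ₁ : F → X₁} {φ₂ : F → X₂} (hK : K = fun u => W (φ₁ u.1) (φ₂ u.2))
    (dec : Matrix (Fin (max k₁ k₂)) (Fin n) F → (Fin n → F) → (Fin n → F) →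
      Decoder F Y n k₁ k₂) :
    ensembleErrorProb W φ₁ φ₂ dec =
      Finset.expect Finset.univ fun m : (Fin k₁ → F) × (Fin k₂ → F) =>
        Finset.expect Finset.univ fun G : Matrix (Fin (max k₁ k₂)) (Fin n) F =>
        Finset.expect Finset.univ fun d : (Fin n → F) × (Fin n → F) =>
        ∑ y : Fin n → Y, if dec G d.1 d.2 y = m then 0 else
          ∏ i, K (wordPair G d m i) (y i) := by
  subst hK
  unfold ensembleErrorProb errorProb
  rw [Finset.expect_comm (s := (Finset.univ : Finset ((Fin k₁ → F) × (Fin k₂ → F))))]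
  refine Finset.expect_congr rfl fun G _ => ?_
  rw [Finset.expect_comm]
  rfl

open Classical in
lemma expect_fail_eq (V : Submodule F (F × F)) (C : ℝ) (m : (Fin k₁ → F) × (Fin k₂ → F)) :
    (Finset.expect Finset.univ fun G : Matrix (Fin (max k₁ k₂)) (Fin n) F =>
      Finset.expect Finset.univ fun d : (Fin n → F) × (Fin n → F) =>
        ∑ y : Fin n → Y, if Passes K V C (wordPair G d m) y then 0 else
          ∏ i, K (wordPair G d m i) (y i)) =
      Finset.expect Finset.univ fun u : Fin n → F × F => ∑ y : Fin n → Y,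
        if Passes K V C u y then 0 else ∏ i, K (u i) (y i) := by
  have h := fun G : Matrix (Fin (max k₁ k₂)) (Fin n) F => expect_wordPair G m
    fun u => ∑ y : Fin n → Y, if Passes K V C u y then 0 else ∏ i, K (u i) (y i)
  rw [Finset.expect_congr rfl fun G _ => h G]
  exact Finset.expect_const Finset.univ_nonempty _

open Classical in
lemma expect_pass_wrong_le {C : ℝ} (hC : 0 < C) (hK₀ : ∀ u y, 0 ≤ K u y)
    (hK₁ : ∀ u, ∑ y, K u y = 1) (m m' : (Fin k₁ → F) × (Fin k₂ → F)) :
    (Finset.expect Finset.univ fun G : Matrix (Fin (max k₁ k₂)) (Fin n) F =>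
      Finset.expect Finset.univ fun d : (Fin n → F) × (Fin n → F) =>
        ∑ y : Fin n → Y, if Passes K (diffSpace (m' - m)) C (wordPair G d m') y
          then ∏ i, K (wordPair G d m i) (y i) else 0) ≤ 1 / C := by
  let h : (Fin n → F × F) → (Fin n → F × F) → ℝ := fun u v => ∑ y : Fin n → Y,
    if Passes K (diffSpace (m' - m)) C (fun i => u i + v i) y then ∏ i, K (u i) (y i) else 0
  let L := Fintype.linearCombination F (fun j : Fin (max k₁ k₂) =>
      (zeroPad (max k₁ k₂) (m' - m).1 j, zeroPad (max k₁ k₂) (m' - m).2 j))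
  calc _ = Finset.expect Finset.univ fun G : Matrix (Fin (max k₁ k₂)) (Fin n) F =>
        Finset.expect Finset.univ fun d : (Fin n → F) × (Fin n → F) =>
          h (wordPair G d m) fun i => L fun j => G j i := by
        refine Finset.expect_congr rfl fun G _ => Finset.expect_congr rfl fun d _ => ?_
        simp only [h, L, ← wordPair_eq_add G d m m']
    _ = Finset.expect Finset.univ fun G : Matrix (Fin (max k₁ k₂)) (Fin n) F =>
        Finset.expect Finset.univ fun u : Fin n → F × F => h u fun i => L fun j => G j i :=
        Finset.expect_congr rfl fun G _ =>
          expect_wordPair G m fun u => h u fun i => L fun j => G j i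
    _ = Finset.expect Finset.univ fun u : Fin n → F × F =>
        Finset.expect Finset.univ fun G : Matrix (Fin (max k₁ k₂)) (Fin n) F =>
          h u fun i => L fun j => G j i := Finset.expect_comm _ _ _
    _ = Finset.expect Finset.univ fun u : Fin n → F × F =>
        Finset.expect Finset.univ fun v : Fin n → diffSpace (m' - m) => h u fun i => v i :=
        Finset.expect_congr rfl fun u _ => expect_matrix_linearCombination (m' - m) (h u)
    _ ≤ 1 / C := Finset.expect_le Finset.univ_nonempty fun u _ =>
        expect_pass_le hC hK₀ hK₁ u

open Classical in
lemma expect_thresholdDecoder_error_le (hK₀ : ∀ u y, 0 ≤ K u y) (hK₁ : ∀ u, ∑ y, K u y = 1)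
    (hB : ∀ V, 0 < B V) (m : (Fin k₁ → F) × (Fin k₂ → F)) :
    (Finset.expect Finset.univ fun G : Matrix (Fin (max k₁ k₂)) (Fin n) F =>
      Finset.expect Finset.univ fun d : (Fin n → F) × (Fin n → F) =>
        ∑ y : Fin n → Y, if thresholdDecoder K B G d.1 d.2 y = m then 0 else
          ∏ i, K (wordPair G d m i) (y i)) ≤
      (∑ V with V ≠ ⊥, Finset.expect Finset.univ fun u : Fin n → F × F => ∑ y : Fin n → Y,
        if Passes K V (B V) u y then 0 else ∏ i, K (u i) (y i)) +
      ∑ m' with m' ≠ m, 1 / B (diffSpace (m' - m)) := by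
  have hpt : ∀ (G : Matrix (Fin (max k₁ k₂)) (Fin n) F) (d : (Fin n → F) × (Fin n → F)),
      (∑ y : Fin n → Y, if thresholdDecoder K B G d.1 d.2 y = m then 0 else
          ∏ i, K (wordPair G d m i) (y i)) ≤
      (∑ V with V ≠ ⊥, ∑ y : Fin n → Y, if Passes K V (B V) (wordPair G d m) y then 0 else
          ∏ i, K (wordPair G d m i) (y i)) +
        ∑ m' with m' ≠ m, ∑ y : Fin n → Y,
          if Passes K (diffSpace (m' - m)) (B (diffSpace (m' - m))) (wordPair G d m') y
            then ∏ i, K (wordPair G d m i) (y i) else 0 := fun G d => by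
    rw [Finset.sum_comm (s := Finset.univ.filter fun V : Submodule F (F × F) => V ≠ ⊥),
      Finset.sum_comm (s := Finset.univ.filter fun m' => m' ≠ m), ← Finset.sum_add_distrib]
    exact Finset.sum_le_sum fun y _ => thresholdDecoder_error_le G d m y
      (Finset.prod_nonneg fun i _ => hK₀ _ _)
  refine (Finset.expect_le_expect fun G _ => Finset.expect_le_expect fun d _ => hpt G d).trans ?_
  simp only [Finset.expect_add_distrib]
  refine add_le_add (le_of_eq ?_) ?_
  · rw [Finset.expect_congr rfl fun G _ => Finset.expect_sum_comm _ _ _, Finset.expect_sum_comm]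
    exact Finset.sum_congr rfl fun V _ => expect_fail_eq V (B V) m
  · rw [Finset.expect_congr rfl fun G _ => Finset.expect_sum_comm _ _ _, Finset.expect_sum_comm]
    exact Finset.sum_le_sum fun m' _ => expect_pass_wrong_le (hB _) hK₀ hK₁ m m'

open Classical in
-- The bound for a fixed message depends on competitors only through `m' - m`; reindexing by the
-- difference makes it the same for all messages.
lemma ensembleErrorProb_thresholdDecoder_le {X₁ X₂ : Type*} {W : X₁ → X₂ → Y → ℝ}
    {φ₁ : F → X₁} {φ₂ : F → X₂} (hW : ∀ x₁ x₂, W x₁ x₂ ∈ stdSimplex ℝ Y)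
    (hK : K = fun u => W (φ₁ u.1) (φ₂ u.2)) (hB : ∀ V, 0 < B V) :
    ensembleErrorProb W φ₁ φ₂ (k₁ := k₁) (k₂ := k₂) (n := n) (thresholdDecoder K B) ≤
      (∑ V with V ≠ ⊥, Finset.expect Finset.univ fun u : Fin n → F × F => ∑ y : Fin n → Y,
        if Passes K V (B V) u y then 0 else ∏ i, K (u i) (y i)) +
      ∑ δ : (Fin k₁ → F) × (Fin k₂ → F) with δ ≠ 0, 1 / B (diffSpace δ) := by
  have hK₀ : ∀ u y, 0 ≤ K u y := fun u y => by rw [hK]; exact (hW _ _).1 y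
  have hK₁ : ∀ u, ∑ y, K u y = 1 := fun u => by rw [hK]; exact (hW _ _).2
  rw [ensembleErrorProb_eq_expect_message hK]
  refine Finset.expect_le Finset.univ_nonempty fun m _ => ?_
  refine (expect_thresholdDecoder_error_le hK₀ hK₁ hB m).trans (le_of_eq ?_)
  congr 1
  rw [Finset.sum_filter, Finset.sum_filter, ← (Equiv.subRight m).sum_comp
    fun δ => if δ ≠ 0 then 1 / B (diffSpace δ) else 0]
  simp [sub_eq_zero]

end Decoding

/-! ### Number of message differences spanning a given subspace -/

section Counting

variable {F : Type*} [Field F] [Fintype F] {k₁ k₂ : ℕ}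

open Classical in
-- A subspace meeting the second axis trivially is a graph over the first coordinate, so the first
-- component of `δ` determines the second.
lemma card_diffSpace_eq_le_left {V : Submodule F (F × F)} (hV : ∀ c, (0, c) ∈ V → c = 0) :
    (Finset.univ.filter fun δ : (Fin k₁ → F) × (Fin k₂ → F) => diffSpace δ = V).card ≤
      Fintype.card F ^ k₁ := by
  have : (Finset.univ : Finset (Fin k₁ → F)).card = Fintype.card F ^ k₁ := by simp
  rw [← this]
  refine Finset.card_le_card_of_injOn Prod.fst (fun _ _ => Finset.mem_coe.2 (Finset.mem_univ _)) ?_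
  intro δ hδ δ' hδ' h
  simp only [Finset.coe_filter, Finset.mem_univ, true_and, Set.mem_ofPred_eq] at hδ hδ'
  refine Prod.ext h (funext fun i => ?_)
  have h₁ := zeroPad_mem_diffSpace δ (Fin.castLE (le_max_right k₁ k₂) i)
  have h₂ := zeroPad_mem_diffSpace δ' (Fin.castLE (le_max_right k₁ k₂) i)
  rw [hδ, zeroPad_apply_castLE] at h₁
  rw [hδ', zeroPad_apply_castLE] at h₂
  have := V.sub_mem h₁ h₂
  rw [h, Prod.mk_sub_mk, sub_self] at this
  exact sub_eq_zero.1 (hV _ this)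

open Classical in
lemma card_diffSpace_eq_le_right {V : Submodule F (F × F)} (hV : ∀ a, (a, 0) ∈ V → a = 0) :
    (Finset.univ.filter fun δ : (Fin k₁ → F) × (Fin k₂ → F) => diffSpace δ = V).card ≤
      Fintype.card F ^ k₂ := by
  have : (Finset.univ : Finset (Fin k₂ → F)).card = Fintype.card F ^ k₂ := by simp
  rw [← this]
  refine Finset.card_le_card_of_injOn Prod.snd (fun _ _ => Finset.mem_coe.2 (Finset.mem_univ _)) ?_
  intro δ hδ δ' hδ' h
  simp only [Finset.coe_filter, Finset.mem_univ, true_and, Set.mem_ofPred_eq] at hδ hδ'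
  refine Prod.ext (funext fun i => ?_) h
  have h₁ := zeroPad_mem_diffSpace δ (Fin.castLE (le_max_left k₁ k₂) i)
  have h₂ := zeroPad_mem_diffSpace δ' (Fin.castLE (le_max_left k₁ k₂) i)
  rw [hδ, zeroPad_apply_castLE] at h₁
  rw [hδ', zeroPad_apply_castLE] at h₂
  have := V.sub_mem h₁ h₂
  rw [h, Prod.mk_sub_mk, sub_self] at this
  exact sub_eq_zero.1 (hV _ this)

open Classical in
lemma card_diffSpace_eq_le (V : Submodule F (F × F)) :
    (Finset.univ.filter fun δ : (Fin k₁ → F) × (Fin k₂ → F) => diffSpace δ = V).card ≤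
      Fintype.card F ^ k₁ * Fintype.card F ^ k₂ :=
  (Finset.card_filter_le _ _).trans (by simp)

/-- Rounding up the number of symbols costs at most one factor of the field size, uniformly in `n`.
-/
lemma card_pow_numSymbols_le {b R : ℝ} (hb : 1 < b) (hR : 0 ≤ R) (n : ℕ) :
    (Fintype.card F : ℝ) ^ numSymbols F b R n ≤ Fintype.card F * b ^ (n * R) := by
  have hq : (1 : ℝ) < Fintype.card F := by exact_mod_cast Fintype.one_lt_card
  have hlog : 0 ≤ Real.logb (Fintype.card F) b := Real.logb_nonneg hq hb.le
  have hk : (numSymbols F b R n : ℝ) ≤ n * R * Real.logb (Fintype.card F) b + 1 :=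
    (Nat.ceil_lt_add_one (by positivity)).le
  rw [← Real.rpow_natCast]
  refine (Real.rpow_le_rpow_of_exponent_le hq.le hk).trans (le_of_eq ?_)
  rw [Real.rpow_add (by linarith), Real.rpow_one, mul_comm (n * R) _, Real.rpow_mul (by linarith),
    Real.rpow_logb (by linarith) hq.ne' (by linarith), mul_comm]

end Counting

/-! ### Reduction of achievability to one inequality per subspace -/

open Classical in
lemma achievableOver_of_card_le {F X₁ X₂ Y : Type*} [Field F] [Fintype F] [Fintype Y] {b : ℝ}
    (hb : 1 < b) {W : X₁ → X₂ → Y → ℝ} (hW : ∀ x₁ x₂, W x₁ x₂ ∈ stdSimplex ℝ Y)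
    {φ₁ : F → X₁} {φ₂ : F → X₂} {R : ℝ × ℝ}
    (h : ∀ V : Submodule F (F × F), V ≠ ⊥ →
      ∃ r C : ℝ, r < cosetInfo b (fun u : F × F => W (φ₁ u.1) (φ₂ u.2)) V ∧
        ∀ n : ℕ, ((Finset.univ.filter fun δ : (Fin (numSymbols F b R.1 n) → F) ×
          (Fin (numSymbols F b R.2 n) → F) => diffSpace δ = V).card : ℝ) ≤ C * b ^ (n * r)) :
    AchievableOver F b W φ₁ φ₂ R := by
  have hb₀ : 0 < b := by linarith
  set K : F × F → Y → ℝ := fun u => W (φ₁ u.1) (φ₂ u.2) with hK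
  have hK₀ : ∀ u y, 0 ≤ K u y := fun u y => (hW _ _).1 y
  have hK₁ : ∀ u, ∑ y, K u y = 1 := fun u => (hW _ _).2
  have key : ∀ V : Submodule F (F × F), ∃ τ c C ρ : ℝ, V ≠ ⊥ →
      0 ≤ c ∧ c < 1 ∧ 0 ≤ ρ ∧ ρ < 1 ∧
      (∀ n : ℕ, (Finset.expect Finset.univ fun u : Fin n → F × F => ∑ y : Fin n → Y,
        if Passes K V (b ^ (n * τ)) u y then 0 else ∏ i, K (u i) (y i)) ≤ c ^ n) ∧
      ∀ n : ℕ, ((Finset.univ.filter fun δ : (Fin (numSymbols F b R.1 n) → F) ×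
          (Fin (numSymbols F b R.2 n) → F) => diffSpace δ = V).card : ℝ) * (1 / b ^ (n * τ)) ≤
        C * ρ ^ n := fun V => by
    by_cases hV : V = ⊥
    · exact ⟨0, 0, 0, 0, fun h => absurd hV h⟩
    obtain ⟨r, C, hr, hC⟩ := h V hV
    -- A threshold exponent above the growth rate of the count kills the wrong pairs at rate `b ^ (r
    -- - τ)`; being below the information, it lets the true pair pass.
    obtain ⟨τ, hrτ, hτ⟩ := exists_between hr
    obtain ⟨c, hc₀, hc₁, hc⟩ := exists_fail_bound hb hK₀ hK₁ hτ
    refine ⟨τ, c, C, b ^ (r - τ), fun _ => ⟨hc₀, hc₁, by positivity,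
      Real.rpow_lt_one_of_one_lt_of_neg hb (by linarith), hc, fun n => ?_⟩⟩
    refine (mul_le_mul_of_nonneg_right (hC n) (by positivity)).trans (le_of_eq ?_)
    rw [← Real.rpow_natCast, ← Real.rpow_mul hb₀.le, mul_assoc, one_div, ← Real.rpow_neg hb₀.le,
      ← Real.rpow_add hb₀]
    ring_nf
  choose τ c C ρ hkey using key
  refine ⟨fun n => thresholdDecoder K fun V => b ^ (n * τ V), ?_⟩
  have hlim : Filter.Tendsto (fun n : ℕ =>
      ∑ V : Submodule F (F × F) with V ≠ ⊥, (c V ^ n + C V * ρ V ^ n)) Filter.atTop (nhds 0) := by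
    have : (0 : ℝ) = ∑ V : Submodule F (F × F) with V ≠ ⊥, (0 + C V * 0) := by simp
    rw [this]
    refine tendsto_finsetSum _ fun V hV => ?_
    obtain ⟨hc₀, hc₁, hρ₀, hρ₁, -⟩ := hkey V (Finset.mem_filter.1 hV).2
    exact (tendsto_pow_atTop_nhds_zero_of_lt_one hc₀ hc₁).add
      ((tendsto_pow_atTop_nhds_zero_of_lt_one hρ₀ hρ₁).const_mul _)
  refine squeeze_zero (fun n => ?_) (fun n => ?_) hlim
  · refine Finset.expect_nonneg fun G _ => Finset.expect_nonneg fun d _ =>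
      Finset.expect_nonneg fun m _ => Finset.sum_nonneg fun y _ => ?_
    split_ifs
    exacts [le_rfl, Finset.prod_nonneg fun i _ => (hW _ _).1 _]
  · refine (ensembleErrorProb_thresholdDecoder_le hW hK fun V =>
      Real.rpow_pos_of_pos hb₀ _).trans ?_
    rw [Finset.sum_add_distrib]
    refine add_le_add (Finset.sum_le_sum fun V hV =>
      (hkey V (Finset.mem_filter.1 hV).2).2.2.2.2.1 n) ?_
    -- Group the differences by the subspace they span, on which the threshold is constant.
    rw [← Finset.sum_fiberwise_of_maps_to (g := diffSpace)
      (t := Finset.univ.filter fun V : Submodule F (F × F) => V ≠ ⊥)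
      fun δ hδ => Finset.mem_filter.2 ⟨Finset.mem_univ _,
        diffSpace_ne_bot (Finset.mem_filter.1 hδ).2⟩]
    refine Finset.sum_le_sum fun V hV => ?_
    refine le_trans ?_ ((hkey V (Finset.mem_filter.1 hV).2).2.2.2.2.2 n)
    rw [Finset.sum_congr rfl fun δ hδ => by rw [(Finset.mem_filter.1 hδ).2], Finset.sum_const,
      nsmul_eq_mul]
    refine mul_le_mul_of_nonneg_right ?_ (by positivity)
    exact_mod_cast Finset.card_le_card (Finset.filter_subset_filter _ (Finset.filter_subset _ _))

/-! ### Coset entropies -/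

section CosetInformation

variable {F A Y : Type*} [Field F] [AddCommGroup A] [Module F A] [Fintype A]
  {K : A → Y → ℝ} {V V' : Submodule F A}

/-- Smoothing is the conditional expectation onto functions of the coset, so it may be dropped
against a factor constant on cosets. -/
lemma expect_smooth_mul {f : A → ℝ} (hf : ∀ u, ∀ v ∈ V, f (u + v) = f u) (y : Y) :
    (Finset.expect Finset.univ fun u => smooth K V u y * f u) =
      Finset.expect Finset.univ fun u => K u y * f u := by
  classical
  simp only [smooth, Finset.expect_mul]
  rw [Finset.expect_comm]
  have : ∀ v : V, (Finset.expect Finset.univ fun u => K (u + v) y * f u) =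
      Finset.expect Finset.univ fun u => K u y * f u := fun v =>
    Fintype.expect_equiv (Equiv.addRight (v : A)) _ _ fun u => by simp [hf u v v.2]
  rw [Finset.expect_congr rfl fun v _ => this v, Finset.expect_const Finset.univ_nonempty]

lemma smooth_range {M : Type*} [AddCommGroup M] [Module F M] [Fintype M] (L : M →ₗ[F] A) (u : A)
    (y : Y) : smooth K (LinearMap.range L) u y =
      Finset.expect Finset.univ fun x => K (u + L x) y := by
  classical
  unfold smooth
  convert (expect_comp_surjective L.rangeRestrict.toAddMonoidHom L.surjective_rangeRestrict
    fun v => K (u + v) y).symm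
  rfl

lemma smooth_top (u : A) (y : Y) :
    smooth K (⊤ : Submodule F A) u y = Finset.expect Finset.univ fun w => K w y := by
  rw [← LinearMap.range_id, smooth_range]
  exact Fintype.expect_equiv (Equiv.addLeft u) _ _ fun x => rfl

lemma smooth_bot (u : A) (y : Y) : smooth K (⊥ : Submodule F A) u y = K u y := by
  classical
  simp only [smooth, Fintype.expect_eq_sum_div_card, Fintype.sum_unique,
    Subsingleton.elim default (0 : (⊥ : Submodule F A))]
  simp

/-- The sum of independent uniform noises on `V` and `V'` is uniform on `V ⊔ V'`. -/
lemma smooth_smooth_of_sup_eq_top (h : V ⊔ V' = ⊤) (u : A) (y : Y) :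
    smooth (smooth K V') V u y = smooth K (⊤ : Submodule F A) u y := by
  classical
  have hr : LinearMap.range (V.subtype.coprod V'.subtype) = ⊤ := by
    rw [LinearMap.range_coprod, Submodule.range_subtype, Submodule.range_subtype, h]
  rw [← hr, smooth_range]
  simp only [smooth, LinearMap.coprod_apply, Submodule.subtype_apply, ← add_assoc]
  rw [← Finset.univ_product_univ, Finset.expect_product]

variable [Fintype Y]

/-- The negative conditional entropy of the output of `K` given the coset of `V` that contains the
uniform input. -/
noncomputable def negCosetEnt (b : ℝ) (K : A → Y → ℝ) (V : Submodule F A) : ℝ :=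
  Finset.expect Finset.univ fun u : A => ∑ y, xlog b (smooth K V u y)

lemma expect_sum_mul_logb_smooth (b : ℝ) :
    (Finset.expect Finset.univ fun u : A => ∑ y, K u y * Real.logb b (smooth K V u y)) =
      negCosetEnt b K V := by
  simp only [negCosetEnt, xlog]
  rw [Finset.expect_sum_comm, Finset.expect_sum_comm]
  refine Finset.sum_congr rfl fun y _ => (expect_smooth_mul (fun u v hv => ?_) y).symm
  rw [smooth_add_mem u hv]

lemma cosetInfo_eq (b : ℝ) : cosetInfo b K V =
    negCosetEnt b K (⊥ : Submodule F A) - negCosetEnt b K V := by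
  rw [← expect_sum_mul_logb_smooth, ← expect_sum_mul_logb_smooth]
  simp only [cosetInfo, smooth_bot, mul_sub, Finset.sum_sub_distrib, Finset.expect_sub_distrib]

/-- Cosets of two subspaces that span the whole space carry together no more information about the
output than the input itself. -/
lemma negCosetEnt_add_le {b : ℝ} (hb : 1 < b) (hK : ∀ u y, 0 ≤ K u y)
    (h : V ⊔ V' = ⊤) : negCosetEnt b K V + negCosetEnt b K V' ≤
      negCosetEnt b K (⊥ : Submodule F A) + negCosetEnt b K (⊤ : Submodule F A) := by
  classical
  have hlogb : 0 < Real.log b := Real.log_pos hb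
  let T : Y → ℝ := fun y => Finset.expect Finset.univ fun w => K w y
  -- Smoothing along `V'` and then `V` yields the overall average `T y`, so the two smoothings are
  -- uncorrelated under a uniform input.
  have hsq : ∀ y, (Finset.expect Finset.univ fun u => smooth K V u y * smooth K V' u y) =
      T y * T y := fun y => by
    have h₁ := expect_smooth_mul (K := smooth K V') (V := V) (f := fun u => smooth K V u y)
      (fun u v hv => smooth_add_mem u hv y) y
    simp only [smooth_smooth_of_sup_eq_top h, smooth_top] at h₁
    have h₂ := expect_smooth_mul (K := K) (V := V) (f := fun _ => 1) (fun _ _ _ => rfl) y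
    simp only [mul_one] at h₂
    rw [Finset.expect_congr rfl fun u _ => mul_comm _ _, ← h₁, ← Finset.mul_expect, h₂]
  -- This is `log t ≤ t - 1` at `t = smooth K V u y * smooth K V' u y / (K u y * T y)`, multiplied
  -- by `K u y`. By `hsq` the left side averages to zero.
  have hpt : ∀ u y, (K u y - smooth K V u y * smooth K V' u y / T y) / Real.log b ≤
      K u y * Real.logb b (K u y) + K u y * Real.logb b (T y) -
        K u y * Real.logb b (smooth K V u y) - K u y * Real.logb b (smooth K V' u y) :=
    fun u y => by
      have hT : 0 ≤ T y := Finset.expect_nonneg fun _ _ => hK _ _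
      have hs := smooth_nonneg (V := V) hK u y
      have hs' := smooth_nonneg (V := V') hK u y
      rcases (hK u y).eq_or_lt with h0 | hpos
      · rw [← h0]
        simp only [zero_sub, zero_mul, add_zero, sub_zero]
        exact div_nonpos_of_nonpos_of_nonneg (neg_nonpos.2 (by positivity)) hlogb.le
      have hT' : 0 < T y := Finset.expect_pos' (fun _ _ => hK _ _) ⟨u, by simp, hpos⟩
      have hs₁ : 0 < smooth K V u y := smooth_pos hK hpos
      have hs₂ : 0 < smooth K V' u y := smooth_pos hK hpos
      have hlog := Real.log_le_sub_one_of_pos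
        (show 0 < smooth K V u y * smooth K V' u y / (K u y * T y) by positivity)
      rw [Real.log_div (by positivity) (by positivity), Real.log_mul hs₁.ne' hs₂.ne',
        Real.log_mul hpos.ne' hT'.ne'] at hlog
      simp only [Real.logb, mul_div_assoc', ← add_div, ← sub_div]
      refine div_le_div_of_nonneg_right ?_ hlogb.le
      have := mul_le_mul_of_nonneg_left hlog hpos.le
      have e : K u y * (smooth K V u y * smooth K V' u y / (K u y * T y) - 1) =
          smooth K V u y * smooth K V' u y / T y - K u y := by field_simp
      rw [e] at this
      linarith
  have hsum : (Finset.expect Finset.univ fun u : A => ∑ y,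
      (K u y - smooth K V u y * smooth K V' u y / T y) / Real.log b) = 0 := by
    rw [Finset.expect_sum_comm]
    refine Finset.sum_eq_zero fun y _ => ?_
    rw [← Finset.expect_div, Finset.expect_sub_distrib, ← Finset.expect_div, hsq,
      mul_self_div_self]
    simp [T]
  have hle := Finset.expect_le_expect fun (u : A) (_ : u ∈ Finset.univ) =>
    Finset.sum_le_sum fun y (_ : y ∈ Finset.univ) => hpt u y
  rw [hsum] at hle
  have hbot := expect_sum_mul_logb_smooth (K := K) (V := (⊥ : Submodule F A)) b
  have htop := expect_sum_mul_logb_smooth (K := K) (V := (⊤ : Submodule F A)) b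
  simp only [smooth_bot] at hbot
  simp only [smooth_top] at htop
  rw [← hbot, ← htop, ← expect_sum_mul_logb_smooth, ← expect_sum_mul_logb_smooth]
  simp only [Finset.sum_add_distrib, Finset.sum_sub_distrib, Finset.expect_add_distrib,
    Finset.expect_sub_distrib] at hle
  linarith

end CosetInformation

/-! ### Approximating pmfs by images of uniform laws -/

section UniformLaw

open Classical in
/-- The law of `φ` under the uniform distribution. -/
noncomputable def unifLaw {F X : Type*} [Fintype F] (φ : F → X) (x : X) : ℝ :=
  ((Finset.univ.filter fun u => φ u = x).card : ℝ) / Fintype.card F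

lemma sum_unifLaw_mul {F X : Type*} [Fintype F] [Fintype X] (φ : F → X) (f : X → ℝ) :
    ∑ x, unifLaw φ x * f x = Finset.expect Finset.univ fun u => f (φ u) := by
  classical
  rw [Fintype.expect_eq_sum_div_card, ← Finset.sum_fiberwise (s := Finset.univ) (g := φ),
    Finset.sum_div]
  refine Finset.sum_congr rfl fun x _ => ?_
  rw [Finset.sum_congr rfl fun u hu => by rw [(Finset.mem_filter.1 hu).2], Finset.sum_const,
    nsmul_eq_mul, unifLaw]
  ring_nf

/-- Every pmf is approximated by laws of functions of uniform random variables. -/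
lemma exists_unifLaw_near {X : Type*} [Fintype X] {p : X → ℝ} (hp : p ∈ stdSimplex ℝ X)
    (F : Type*) [Fintype F] [Nonempty F] :
    ∃ φ : F → X, ∀ x, |unifLaw φ x - p x| ≤ (Fintype.card X : ℝ) / Fintype.card F := by
  classical
  obtain ⟨hp₀, hp₁⟩ := hp
  have hX : Nonempty X := by
    by_contra h
    rw [not_nonempty_iff] at h
    simp at hp₁
  obtain ⟨x₀⟩ := hX
  set N := Fintype.card F with hN
  have hNpos : (0 : ℝ) < N := by exact_mod_cast Fintype.card_pos
  let a : X → ℕ := fun x => ⌊(N : ℝ) * p x⌋₊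
  have ha : ∀ x, (a x : ℝ) ≤ N * p x := fun x => Nat.floor_le (mul_nonneg hNpos.le (hp₀ x))
  have ha' : ∀ x, N * p x ≤ a x + 1 := fun x => (Nat.lt_floor_add_one _).le
  have hsum : ∑ x, (N : ℝ) * p x = N := by rw [← Finset.mul_sum, hp₁, mul_one]
  have hle : ∑ x, a x ≤ N := by
    have : (∑ x, (a x : ℝ)) ≤ N := hsum ▸ Finset.sum_le_sum fun x _ => ha x
    exact_mod_cast this
  have hge : (N : ℝ) ≤ ∑ x, (a x : ℝ) + Fintype.card X := by
    have : ∑ x, (N : ℝ) * p x ≤ ∑ x, ((a x : ℝ) + 1) := Finset.sum_le_sum fun x _ => ha' x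
    rw [hsum, Finset.sum_add_distrib] at this
    simpa using this
  -- Rounding every `N * p x` down leaves at most one unassigned element per letter; all of them go
  -- to `x₀`.
  let r := N - ∑ x, a x
  have hr : (r : ℝ) = N - ∑ x, (a x : ℝ) := by
    simp only [r]; rw [Nat.cast_sub hle]; push_cast; rfl
  let c : X → ℕ := fun x => a x + if x = x₀ then r else 0
  have hc : ∑ x, c x = N := by
    simp only [c, Finset.sum_add_distrib, Finset.sum_ite_eq', Finset.mem_univ, if_true, r]
    omega
  have e : F ≃ Σ x : X, Fin (c x) := Fintype.equivOfCardEq (by simp [hc, hN])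
  refine ⟨fun u => (e u).1, fun x => ?_⟩
  have hcard : (Finset.univ.filter fun u => (e u).1 = x).card = c x := by
    rw [← Fintype.card_subtype, Fintype.card_congr ((e.subtypeEquiv fun u => Iff.rfl).trans
      (Equiv.sigmaSubtype x))]
    simp
  have hcle : |(c x : ℝ) - N * p x| ≤ Fintype.card X := by
    have hX1 : (1 : ℝ) ≤ Fintype.card X := by
      exact_mod_cast Fintype.card_pos_iff.2 ⟨x₀⟩
    have h1 := ha x
    have h2 := ha' x
    rw [abs_le]
    simp only [c, Nat.cast_add]
    have hrX : (r : ℝ) ≤ Fintype.card X := by rw [hr]; linarith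
    have hr0 : (0 : ℝ) ≤ r := Nat.cast_nonneg _
    split_ifs <;> constructor <;> push_cast <;> linarith
  have : unifLaw (fun u => (e u).1) x - p x = ((c x : ℝ) - N * p x) / N := by
    rw [unifLaw, sub_div, mul_div_cancel_left₀ _ hNpos.ne', ← hcard]
  rw [this, abs_div, abs_of_pos hNpos]
  exact div_le_div_of_nonneg_right hcle hNpos.le

end UniformLaw

/-! ### Coset entropies of the virtual channel -/

section Product

variable {F X₁ X₂ Y : Type*} [Fintype F] [Fintype X₁] [Fintype X₂] [Fintype Y]
  {b : ℝ} {W : X₁ → X₂ → Y → ℝ} {φ₁ : F → X₁} {φ₂ : F → X₂}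

lemma sum_sum_unifLaw_mul (φ₁ : F → X₁) (φ₂ : F → X₂) (f : X₁ → X₂ → ℝ) :
    ∑ x₁, ∑ x₂, unifLaw φ₁ x₁ * unifLaw φ₂ x₂ * f x₁ x₂ =
      Finset.expect Finset.univ fun u : F × F => f (φ₁ u.1) (φ₂ u.2) := by
  simp only [mul_assoc, ← Finset.mul_sum, sum_unifLaw_mul]
  rw [← Finset.univ_product_univ, Finset.expect_product]

variable [Field F]

lemma expect_fst (g : F → ℝ) : (Finset.expect Finset.univ fun u : F × F => g u.1) =
    Finset.expect Finset.univ g := by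
  rw [← Finset.univ_product_univ, Finset.expect_product]
  simp [Finset.expect_const Finset.univ_nonempty]

lemma expect_snd (g : F → ℝ) : (Finset.expect Finset.univ fun u : F × F => g u.2) =
    Finset.expect Finset.univ g := by
  rw [← Finset.univ_product_univ, Finset.expect_product]
  simp [Finset.expect_const Finset.univ_nonempty]

lemma negCosetEnt_bot : negCosetEnt b (fun u : F × F => W (φ₁ u.1) (φ₂ u.2))
    (⊥ : Submodule F (F × F)) = negEntBoth b W (unifLaw φ₁) (unifLaw φ₂) := by
  simp only [negCosetEnt, smooth_bot, negEntBoth, ← Finset.mul_sum]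
  exact (sum_sum_unifLaw_mul φ₁ φ₂ fun x₁ x₂ => ∑ y, xlog b (W x₁ x₂ y)).symm

lemma negCosetEnt_top : negCosetEnt b (fun u : F × F => W (φ₁ u.1) (φ₂ u.2))
    (⊤ : Submodule F (F × F)) = negEntOut b W (unifLaw φ₁) (unifLaw φ₂) := by
  simp only [negCosetEnt, smooth_top, negEntOut, sum_sum_unifLaw_mul]
  exact Finset.expect_const Finset.univ_nonempty _

/-- Noise along the first axis averages out the first input, so the coset reveals exactly the
second. -/
lemma negCosetEnt_inl : negCosetEnt b (fun u : F × F => W (φ₁ u.1) (φ₂ u.2))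
    (LinearMap.range (LinearMap.inl F F F)) = negEntSnd b W (unifLaw φ₁) (unifLaw φ₂) := by
  have h : ∀ (u : F × F) (y : Y), smooth (fun u : F × F => W (φ₁ u.1) (φ₂ u.2))
      (LinearMap.range (LinearMap.inl F F F)) u y = ∑ x₁, unifLaw φ₁ x₁ * W x₁ (φ₂ u.2) y :=
    fun u y => by
      rw [smooth_range, sum_unifLaw_mul φ₁ fun x₁ => W x₁ (φ₂ u.2) y]
      exact Fintype.expect_equiv (Equiv.addLeft u.1) _ _ fun x => by simp
  simp only [negCosetEnt, h, negEntSnd, ← Finset.mul_sum]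
  rw [sum_unifLaw_mul φ₂ fun x₂ => ∑ y, xlog b (∑ x₁, unifLaw φ₁ x₁ * W x₁ x₂ y)]
  exact expect_snd fun c => ∑ y, xlog b (∑ x₁, unifLaw φ₁ x₁ * W x₁ (φ₂ c) y)

lemma negCosetEnt_inr : negCosetEnt b (fun u : F × F => W (φ₁ u.1) (φ₂ u.2))
    (LinearMap.range (LinearMap.inr F F F)) = negEntFst b W (unifLaw φ₁) (unifLaw φ₂) := by
  have h : ∀ (u : F × F) (y : Y), smooth (fun u : F × F => W (φ₁ u.1) (φ₂ u.2))
      (LinearMap.range (LinearMap.inr F F F)) u y = ∑ x₂, unifLaw φ₂ x₂ * W (φ₁ u.1) x₂ y :=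
    fun u y => by
      rw [smooth_range, sum_unifLaw_mul φ₂ fun x₂ => W (φ₁ u.1) x₂ y]
      exact Fintype.expect_equiv (Equiv.addLeft u.2) _ _ fun x => by simp
  simp only [negCosetEnt, h, negEntFst, ← Finset.mul_sum]
  rw [sum_unifLaw_mul φ₁ fun x₁ => ∑ y, xlog b (∑ x₂, unifLaw φ₂ x₂ * W x₁ x₂ y)]
  exact expect_fst fun a => ∑ y, xlog b (∑ x₂, unifLaw φ₂ x₂ * W (φ₁ a) x₂ y)

end Product

/-! ### Subspaces of the plane -/

section Lines

variable {F : Type*} [Field F] {V : Submodule F (F × F)}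

lemma sup_range_inr_eq_top {a c : F} (h : (a, c) ∈ V) (ha : a ≠ 0) :
    V ⊔ LinearMap.range (LinearMap.inr F F F) = ⊤ := by
  refine eq_top_iff.2 fun w _ => Submodule.mem_sup.2
    ⟨(w.1 / a) • (a, c), V.smul_mem _ h, (0, w.2 - w.1 / a * c), ⟨_, rfl⟩, ?_⟩
  ext <;> simp [ha]

lemma sup_range_inl_eq_top {a c : F} (h : (a, c) ∈ V) (hc : c ≠ 0) :
    V ⊔ LinearMap.range (LinearMap.inl F F F) = ⊤ := by
  refine eq_top_iff.2 fun w _ => Submodule.mem_sup.2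
    ⟨(w.2 / c) • (a, c), V.smul_mem _ h, (w.1 - w.2 / c * a, 0), ⟨_, rfl⟩, ?_⟩
  ext <;> simp [hc]

lemma range_inr_le {c : F} (h : ((0 : F), c) ∈ V) (hc : c ≠ 0) :
    LinearMap.range (LinearMap.inr F F F) ≤ V := by
  rintro _ ⟨x, rfl⟩
  have := V.smul_mem (x / c) h
  simpa [hc] using this

lemma range_inl_le {a : F} (h : (a, (0 : F)) ∈ V) (ha : a ≠ 0) :
    LinearMap.range (LinearMap.inl F F F) ≤ V := by
  rintro _ ⟨x, rfl⟩
  have := V.smul_mem (x / a) h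
  simpa [ha] using this

/-- A subspace of the plane is the whole plane, a coordinate axis, or meets both axes trivially. -/
lemma eq_top_or_axis_or_disjoint (V : Submodule F (F × F)) (hV : V ≠ ⊥) :
    V = ⊤ ∨ V = LinearMap.range (LinearMap.inl F F F) ∨
      V = LinearMap.range (LinearMap.inr F F F) ∨
      (∀ c, (0, c) ∈ V → c = 0) ∧ (∀ a, (a, 0) ∈ V → a = 0) ∧
        ∃ a c, (a, c) ∈ V ∧ a ≠ 0 ∧ c ≠ 0 := by
  by_cases h₁ : ∀ c, (0, c) ∈ V → c = 0
  · by_cases h₂ : ∀ a, (a, 0) ∈ V → a = 0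
    · obtain ⟨⟨a, c⟩, hv, hne⟩ := V.exists_mem_ne_zero_of_ne_bot hV
      refine Or.inr (Or.inr (Or.inr ⟨h₁, h₂, a, c, hv, ?_, ?_⟩))
      · rintro rfl
        exact hne (by simp [h₁ c hv])
      · rintro rfl
        exact hne (by simp [h₂ a hv])
    · push Not at h₂
      obtain ⟨a, ha, ha₀⟩ := h₂
      refine Or.inr (Or.inl (le_antisymm ?_ (range_inl_le ha ha₀)))
      rintro ⟨x, c⟩ hx
      have hxV : (x, (0 : F)) ∈ V := range_inl_le ha ha₀ ⟨x, rfl⟩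
      have := V.sub_mem hx hxV
      rw [Prod.mk_sub_mk, sub_self, sub_zero] at this
      exact ⟨x, by simp [h₁ c this]⟩
  · push Not at h₁
    obtain ⟨c, hc, hc₀⟩ := h₁
    have hle := range_inr_le hc hc₀
    by_cases h : ∀ v ∈ V, v.1 = 0
    · refine Or.inr (Or.inr (Or.inl (le_antisymm ?_ hle)))
      rintro ⟨x, d⟩ hx
      exact ⟨d, by simpa using (h _ hx).symm⟩
    · push Not at h
      obtain ⟨⟨a, d⟩, hv, ha⟩ := h
      left
      rw [← sup_range_inr_eq_top hv ha, sup_eq_left.2 hle]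

end Lines

/-! ### Rate conditions and conclusion -/

/-- Achievability of a rate pair over a finite field when the virtual input pmfs, the laws of
`φ₁` and `φ₂` under the uniform distribution, satisfy the rate conditions. -/
lemma achievableOver_of_rates {F X₁ X₂ Y : Type*} [Field F] [Fintype F] [Fintype X₁]
    [Fintype X₂] [Fintype Y] {b : ℝ} (hb : 1 < b) {W : X₁ → X₂ → Y → ℝ}
    (hW : ∀ x₁ x₂, W x₁ x₂ ∈ stdSimplex ℝ Y) {φ₁ : F → X₁} {φ₂ : F → X₂} {R₁ R₂ : ℝ}
    (hR₁ : 0 ≤ R₁) (hR₂ : 0 ≤ R₂)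
    (h₁ : R₁ < negEntBoth b W (unifLaw φ₁) (unifLaw φ₂) -
      negEntSnd b W (unifLaw φ₁) (unifLaw φ₂))
    (h₂ : R₂ < negEntBoth b W (unifLaw φ₁) (unifLaw φ₂) -
      negEntFst b W (unifLaw φ₁) (unifLaw φ₂))
    (h₁₂ : R₁ + R₂ < negEntBoth b W (unifLaw φ₁) (unifLaw φ₂) -
      negEntOut b W (unifLaw φ₁) (unifLaw φ₂))
    (hmin : min R₁ R₂ < max
      (negEntFst b W (unifLaw φ₁) (unifLaw φ₂) - negEntOut b W (unifLaw φ₁) (unifLaw φ₂))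
      (negEntSnd b W (unifLaw φ₁) (unifLaw φ₂) - negEntOut b W (unifLaw φ₁) (unifLaw φ₂))) :
    AchievableOver F b W φ₁ φ₂ (R₁, R₂) := by
  classical
  have hb₀ : 0 < b := by linarith
  have hK : ∀ (u : F × F) (y : Y), 0 ≤ W (φ₁ u.1) (φ₂ u.2) y := fun u y => (hW _ _).1 y
  refine achievableOver_of_card_le hb hW fun V hV => ?_
  simp only [cosetInfo_eq, negCosetEnt_bot]
  have hleft : (∀ c, ((0 : F), c) ∈ V → c = 0) → ∀ n : ℕ,
      ((Finset.univ.filter fun δ : (Fin (numSymbols F b R₁ n) → F) ×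
          (Fin (numSymbols F b R₂ n) → F) => diffSpace δ = V).card : ℝ) ≤
        Fintype.card F * b ^ (n * R₁) := fun hd n =>
    le_trans (by exact_mod_cast card_diffSpace_eq_le_left hd) (card_pow_numSymbols_le hb hR₁ n)
  have hright : (∀ a, (a, (0 : F)) ∈ V → a = 0) → ∀ n : ℕ,
      ((Finset.univ.filter fun δ : (Fin (numSymbols F b R₁ n) → F) ×
          (Fin (numSymbols F b R₂ n) → F) => diffSpace δ = V).card : ℝ) ≤
        Fintype.card F * b ^ (n * R₂) := fun hd n =>
    le_trans (by exact_mod_cast card_diffSpace_eq_le_right hd) (card_pow_numSymbols_le hb hR₂ n)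
  rcases eq_top_or_axis_or_disjoint V hV with rfl | rfl | rfl | ⟨hd₁, hd₂, a, c, hac, ha, hc⟩
  · refine ⟨R₁ + R₂, Fintype.card F * Fintype.card F, by rwa [negCosetEnt_top], fun n => ?_⟩
    have := mul_le_mul (card_pow_numSymbols_le (F := F) hb hR₁ n)
      (card_pow_numSymbols_le (F := F) hb hR₂ n) (by positivity) (by positivity)
    refine le_trans (by exact_mod_cast card_diffSpace_eq_le ⊤) (this.trans (le_of_eq ?_))
    rw [mul_add, Real.rpow_add hb₀]
    ring
  · refine ⟨R₁, Fintype.card F, by rwa [negCosetEnt_inl], hleft fun c hc => ?_⟩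
    obtain ⟨x, hx⟩ := hc
    simpa using (congrArg Prod.snd hx).symm
  · refine ⟨R₂, Fintype.card F, by rwa [negCosetEnt_inr], hright fun a ha => ?_⟩
    obtain ⟨x, hx⟩ := ha
    simpa using (congrArg Prod.fst hx).symm
  · have hi := negCosetEnt_add_le hb hK (sup_range_inl_eq_top hac hc)
    have hj := negCosetEnt_add_le hb hK (sup_range_inr_eq_top hac ha)
    rw [negCosetEnt_inl, negCosetEnt_bot, negCosetEnt_top] at hi
    rw [negCosetEnt_inr, negCosetEnt_bot, negCosetEnt_top] at hj
    have hlt := hmin.trans_le (max_le (show _ ≤ negEntBoth b W (unifLaw φ₁) (unifLaw φ₂) -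
      negCosetEnt b (fun u : F × F => W (φ₁ u.1) (φ₂ u.2)) V by linarith) (by linarith))
    -- The line meets both axes trivially, so both counting bounds hold and the smaller rate may be
    -- used.
    refine ⟨min R₁ R₂, Fintype.card F, hlt, ?_⟩
    rcases min_choice R₁ R₂ with h | h <;> rw [h]
    exacts [hleft hd₁, hright hd₂]

/-- Finite fields carry virtual inputs whose images approximate any two given pmfs. -/
lemma exists_field_unifLaw_mem {X₁ X₂ : Type*} [Fintype X₁] [Fintype X₂] {p₁ : X₁ → ℝ}
    {p₂ : X₂ → ℝ} (hp₁ : p₁ ∈ stdSimplex ℝ X₁) (hp₂ : p₂ ∈ stdSimplex ℝ X₂)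
    {S : Set ((X₁ → ℝ) × (X₂ → ℝ))} (hS : S ∈ nhds (p₁, p₂)) :
    ∃ (F : Type) (_ : Field F) (_ : Fintype F) (φ₁ : F → X₁) (φ₂ : F → X₂),
      (unifLaw φ₁, unifLaw φ₂) ∈ S := by
  obtain ⟨ε, hε, hball⟩ := Metric.mem_nhds_iff.1 hS
  -- The approximation errors over `ZMod q` are at most `card X₁ / q` and `card X₂ / q`, so this
  -- makes both smaller than `ε` for every prime `q ≥ N`.
  obtain ⟨N, hN⟩ := exists_nat_gt (((Fintype.card X₁ : ℝ) + Fintype.card X₂) / ε)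
  obtain ⟨q, hqN, hq⟩ := Nat.exists_infinite_primes N
  have : Fact q.Prime := ⟨hq⟩
  obtain ⟨φ₁, hφ₁⟩ := exists_unifLaw_near hp₁ (ZMod q)
  obtain ⟨φ₂, hφ₂⟩ := exists_unifLaw_near hp₂ (ZMod q)
  have hq₀ : (0 : ℝ) < q := by exact_mod_cast hq.pos
  have hsmall : ((Fintype.card X₁ : ℝ) + Fintype.card X₂) / q < ε := by
    rw [div_lt_iff₀ hε] at hN
    rw [div_lt_iff₀ hq₀]
    have : (N : ℝ) ≤ q := by exact_mod_cast hqN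
    nlinarith
  rw [add_div] at hsmall
  have h₁ : (0 : ℝ) ≤ (Fintype.card X₁ : ℝ) / q := by positivity
  have h₂ : (0 : ℝ) ≤ (Fintype.card X₂ : ℝ) / q := by positivity
  simp only [ZMod.card] at hφ₁ hφ₂
  refine ⟨ZMod q, inferInstance, inferInstance, φ₁, φ₂, hball ?_⟩
  rw [Metric.mem_ball, Prod.dist_eq, max_lt_iff]
  refine ⟨(dist_pi_lt_iff hε).2 fun x => ?_, (dist_pi_lt_iff hε).2 fun x => ?_⟩
  · exact (hφ₁ x).trans_lt (by linarith)
  · exact (hφ₂ x).trans_lt (by linarith)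

end CosetMAC

theorem mainTheorem7 {X₁ X₂ Y : Type*} [Fintype X₁] [Fintype X₂] [Fintype Y]
    (b : ℝ) (hb : 1 < b)
    (W : X₁ → X₂ → Y → ℝ) (hW : ∀ x₁ x₂, W x₁ x₂ ∈ stdSimplex ℝ Y)
    (R₁ R₂ : ℝ) (hR₁ : 0 ≤ R₁) (hR₂ : 0 ≤ R₂)
    (hR : ∃ p₁ ∈ stdSimplex ℝ X₁, ∃ p₂ ∈ stdSimplex ℝ X₂,
      (R₁, R₂) ∈ CosetMAC.macRegion b p₁ p₂ W ∩ CosetMAC.minRegion b p₁ p₂ W) :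
    CosetMAC.AchievableByCosetCodes b W (R₁, R₂) := by
  open CosetMAC in
  obtain ⟨p₁, hp₁, p₂, hp₂, ⟨h₁, h₂, h₁₂⟩, hmin⟩ := hR
  have hW₁ : ∀ x₁ x₂, ∑ y, W x₁ x₂ y = 1 := fun x₁ x₂ => (hW x₁ x₂).2
  simp only [minRegion, Set.mem_ofPred_eq] at hmin
  rw [mutualInfo_fst hp₂.2 hW₁, mutualInfo_snd hp₁.2 hW₁] at hmin
  rw [condMutualInfo_fst hp₁.2 hW₁] at h₁
  rw [condMutualInfo_snd hp₂.2 hW₁] at h₂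
  rw [mutualInfo_inputs hW₁] at h₁₂
  have cB := continuous_negEntBoth b W
  have c₁ := continuous_negEntFst b W
  have c₂ := continuous_negEntSnd b W
  have cO := continuous_negEntOut b W
  -- Each strict rate condition persists in a neighbourhood of `(p₁, p₂)`, which leaves room to
  -- replace the pmfs by realizable ones.
  have e₁ := ((cB.sub c₂).tendsto (p₁, p₂)).eventually (lt_mem_nhds h₁)
  have e₂ := ((cB.sub c₁).tendsto (p₁, p₂)).eventually (lt_mem_nhds h₂)
  have e₁₂ := ((cB.sub cO).tendsto (p₁, p₂)).eventually (lt_mem_nhds h₁₂)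
  have em := (((c₁.sub cO).max (c₂.sub cO)).tendsto (p₁, p₂)).eventually (lt_mem_nhds hmin)
  obtain ⟨F, hF, hF', φ₁, φ₂, ⟨hf₁, hf₂⟩, hf₁₂, hfm⟩ := exists_field_unifLaw_mem hp₁ hp₂
    ((e₁.and e₂).and (e₁₂.and em))
  exact ⟨F, hF, hF', φ₁, φ₂, achievableOver_of_rates hb hW hR₁ hR₂ hf₁ hf₂ hf₁₂ hfm⟩
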